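/- Let $K\ge 3$, let $\mathsf P$ be the family of non-empty subsets of $[1:K]=\{1,\dots,K\}$, and for each $S\in\mathsf P$ let $C_S\ge 0$ be a real number. In the $K$-user combination network the source $X$ is connected to an intermediate node $V_S$ by a noiseless link of capacity $C_S$ bits per channel use (for each $S\in\mathsf P$), and receiver $Y_i$ observes noiselessly all $V_S$ with $i\in S$, so that in $n$ channel uses the link to $V_S$ carries one of $\lfloor 2^{nC_S}\rfloor$ values. If all the numbers $2^{C_S}$ are integers, one may equivalently take the memoryless deterministic broadcast channel with input $X=(V_S)_{S\in\mathsf P}$, $V_S\in\mathcal V_S$, $|\mathcal V_S|=2^{C_S}$, and outputs $Y_i=(V_S)_{S\ni i}$; the statement below holds for both models. Write $S_l=\{K-1,K\}$ (the common receivers) and $S_p=[1:K]\setminus S_l$ (the private receivers). Two independent, uniformly distributed messages are sent: a private message of rate $R_p$, to be decoded by every receiver in $S_p$, and a common message of rate $R_c$, to be decoded by all $K$ receivers (message index set $\mathsf E=\{S_p,[1:K]\}$). In a code of block length $n$ a message of rate $R\ge0$ takes values in $[1:2^{nR}]$. A rate pair is achievable if there are codes, one for each block length $n$, for which the probability that not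 all receivers decode their intended messages correctly tends to $0$ as $n\to\infty$; the capacity region is the closure of the set of achievable pairs. For $i\in[1:K]$ let $\mathsf W_i=\{S\in\mathsf P: i\in S\}$ and $\downarrow_{\mathsf W_i}\{S_p\}=\{S\in\mathsf W_i: S\subseteq S_p\}$, and for $\mathsf W\subseteq\mathsf P$ let $C_{\mathsf W}=\sum_{S\in\mathsf W}C_S$. Then the capacity region is the set of all pairs $(R_p,R_c)$ of non-negative real numbers such that \begin{align*} R_c&\le C_{\mathsf W_i} && \text{for all } i\in S_l,\\ R_c+R_p&\le C_{\mathsf W_j} && \text{for all } j\in S_p,\\ 2R_c+R_p&\le C_{\downarrow_{\mathsf W_j}\{S_p\}}+C_{\mathsf W_{K-1}}+C_{\mathsf W_K} && \text{for all } j\in S_p. \end{align*} -/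

import Mathlib

open Filter Topology

namespace CombNet

noncomputable section

/-! Receivers are indexed by `Fin K`; a message index is a set of receivers. -/

/-- The family of all non-empty subsets of the set of receivers. -/
def P (K : ℕ) : Finset (Finset (Fin K)) :=
  Finset.univ.filter fun S => S.Nonempty

/-- The members of the family `F` that contain the receiver `i`. -/
def W {K : ℕ} (i : Fin K) (F : Finset (Finset (Fin K))) : Finset (Finset (Fin K)) :=
  F.filter fun S => i ∈ S

theorem W_subset {K : ℕ} {i : Fin K} {F : Finset (Finset (Fin K))} : W i F ⊆ F :=
  Finset.filter_subset _ _

/-- The smallest down-set of `P K` (ordered by inclusion) containing `Q`. -/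
def down {K : ℕ} (Q : Finset (Finset (Fin K))) : Finset (Finset (Fin K)) :=
  (P K).filter fun S => ∃ T ∈ Q, S ⊆ T

/-- The down-set of `Q₁` in `Q₂`, that is `↓_{Q₂} Q₁`. -/
def downIn {K : ℕ} (Q₂ Q₁ : Finset (Finset (Fin K))) : Finset (Finset (Fin K)) :=
  down Q₁ ∩ Q₂

/-- The modular set function `C_F = ∑_{S ∈ F} C_S`. -/
def cap {K : ℕ} (C : Finset (Fin K) → ℝ) (F : Finset (Finset (Fin K))) : ℝ :=
  ∑ S ∈ F, C S

/-- A finite-alphabet broadcast channel with `K` receivers: `law x y` is the probability that the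
receivers observe `y = (y_k)_k` when `x` is sent. -/
structure BroadcastChannel (K : ℕ) where
  In : Type
  Out : Fin K → Type
  [fintypeOut : ∀ k, Fintype (Out k)]
  law : In → (∀ k, Out k) → ℝ
  law_nonneg : ∀ x y, 0 ≤ law x y
  law_sum : ∀ x, ∑ y, law x y = 1

attribute [instance] BroadcastChannel.fintypeOut

/-- `n` uses of the broadcast channel, without memory: the input is a sequence `x^n`, receiver `k`
observes `y_k^n`, and the transition probability is `∏_t law (x_t) (y_{1,t}, …, y_{K,t})`. -/
def BroadcastChannel.power {K : ℕ} (ch : BroadcastChannel K) (n : ℕ) : BroadcastChannel K where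
  In := Fin n → ch.In
  Out k := Fin n → ch.Out k
  law x y := ∏ t, ch.law (x t) (fun k => y k t)
  law_nonneg x y := Finset.prod_nonneg fun t _ => ch.law_nonneg _ _
  law_sum x := by
    classical
    rw [← Equiv.sum_comp (Equiv.piComm fun (_ : Fin n) (k : Fin K) => ch.Out k)
      (fun y : (∀ k, Fin n → ch.Out k) => ∏ t, ch.law (x t) (fun k => y k t))]
    have h := Finset.prod_univ_sum (fun _ : Fin n => (Finset.univ : Finset (∀ k, ch.Out k)))
      (fun t y => ch.law (x t) y)
    rw [Fintype.piFinset_univ] at h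
    simp only [ch.law_sum, Finset.prod_const_one] at h
    exact h.symm

/-- A block code for the channel `ch` and the message set `E`, with `M S` possible values of the
message intended for the receivers in `S ∈ E`. The decoder of receiver `k` outputs an estimate of
the messages with index in `W k E`. -/
structure Code {K : ℕ} (ch : BroadcastChannel K) (E : Finset (Finset (Fin K))) (M : E → ℕ) where
  enc : (∀ S : E, Fin (M S)) → ch.In
  dec : ∀ k, ch.Out k → ∀ S : W k E, Fin (M ⟨S.1, W_subset S.2⟩)

open Classical in
/-- The probability, for independent and uniformly distributed messages, that not all receivers
decode all their intended messages correctly. -/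
def Code.errorProb {K : ℕ} {ch : BroadcastChannel K} {E : Finset (Finset (Fin K))} {M : E → ℕ}
    (c : Code ch E M) : ℝ :=
  (∑ m : (∀ S : E, Fin (M S)), ∑ y : (∀ k, ch.Out k),
      ch.law (c.enc m) y *
        (if ∀ k, c.dec k (y k) = (fun S : W k E => m ⟨S.1, W_subset S.2⟩) then 0 else 1)) /
    Fintype.card (∀ S : E, Fin (M S))

/-- Achievability of the rate tuple `R` over a network that is used in blocks, where `net n` is the
channel seen by a block code of length `n`. The message with index `S` takes values in a set with
`⌊2 ^ (n R_S)⌋` elements. -/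
def Achievable {K : ℕ} (net : ℕ → BroadcastChannel K) (E : Finset (Finset (Fin K)))
    (R : E → ℝ) : Prop :=
  (∀ S, 0 ≤ R S) ∧
    ∃ c : ∀ n : ℕ, Code (net n) E (fun S => ⌊(2 : ℝ) ^ ((n : ℝ) * R S)⌋₊),
      Tendsto (fun n => (c n).errorProb) atTop (𝓝 0)

/-- The capacity region: the closure of the set of achievable rate tuples. -/
def capacityRegion {K : ℕ} (net : ℕ → BroadcastChannel K) (E : Finset (Finset (Fin K))) :
    Set (E → ℝ) :=
  closure {R | Achievable net E R}

open Classical in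
/-- The noiseless channel whose input has one component `V_S` in an alphabet of size `v S` for
every non-empty set `S` of receivers, where receiver `k` observes exactly the components `V_S`
with `k ∈ S`. -/
def combChannel {K : ℕ} (v : Finset (Fin K) → ℕ) : BroadcastChannel K where
  In := ∀ S : P K, Fin (v S.1)
  Out k := ∀ S : W k (P K), Fin (v S.1)
  law x y := if y = (fun k (S : W k (P K)) => x ⟨S.1, W_subset S.2⟩) then 1 else 0
  law_nonneg x y := by split_ifs <;> norm_num
  law_sum x := by simp

/-- The combination network as a discrete memoryless broadcast channel: component alphabets of
sizes `v S`, used `n` times. -/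
def combDMBC {K : ℕ} (v : Finset (Fin K) → ℕ) (n : ℕ) : BroadcastChannel K :=
  (combChannel v).power n

/-- The combination network in which the source is connected to the intermediate node `V_S` by a
noiseless link of capacity `C S` bits per channel use: in `n` uses the link carries one of
`⌊2 ^ (n C_S)⌋` values, which is passed on unchanged to all receivers in `S`. -/
def combLinks {K : ℕ} (C : Finset (Fin K) → ℝ) (n : ℕ) : BroadcastChannel K :=
  combChannel fun S => ⌊(2 : ℝ) ^ ((n : ℝ) * C S)⌋₊

/-- The common receivers: the last two of the `K` receivers. -/
def commonRecv (K : ℕ) : Finset (Fin K) :=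
  Finset.univ.filter fun i => K ≤ i.1 + 2

/-- The private receivers: all the others. -/
def privRecv (K : ℕ) : Finset (Fin K) := (commonRecv K)ᶜ

/-- Two nested messages: a private one for `privRecv K` and a common one for all receivers. -/
def nested (K : ℕ) : Finset (Finset (Fin K)) := {privRecv K, Finset.univ}

/-- The rate of the private message. -/
def rateP {K : ℕ} (R : nested K → ℝ) : ℝ := R ⟨privRecv K, by simp [nested]⟩

/-- The rate of the common message. -/
def rateC {K : ℕ} (R : nested K → ℝ) : ℝ := R ⟨Finset.univ, by simp [nested]⟩

/-- The non-negative rate pairs that satisfy the three groups of inequalities. The last two sums on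
the right-hand side of the third group are taken together, as a sum over the two common
receivers. -/
def region {K : ℕ} (C : Finset (Fin K) → ℝ) : Set (nested K → ℝ) :=
  {R | 0 ≤ rateC R ∧ 0 ≤ rateP R ∧
    (∀ i ∈ commonRecv K, rateC R ≤ cap C (W i (P K))) ∧
    (∀ j ∈ privRecv K, rateC R + rateP R ≤ cap C (W j (P K))) ∧
    (∀ j ∈ privRecv K, 2 * rateC R + rateP R ≤
      cap C (downIn (W j (P K)) {privRecv K}) + ∑ i ∈ commonRecv K, cap C (W i (P K)))}

end

end CombNet

namespace CombNet

/-! ### Channels up to relabelling -/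

/-- If `ch'` is `ch` with inputs and outputs relabelled, then codes can be carried over. -/
theorem Code.exists_relabel {K : ℕ} {ch ch' : BroadcastChannel K} {E : Finset (Finset (Fin K))}
    {M : E → ℕ} (eIn : ch.In ≃ ch'.In) (eOut : ∀ k, ch.Out k ≃ ch'.Out k)
    (hlaw : ∀ x y, ch'.law (eIn x) (fun k => eOut k (y k)) = ch.law x y) (c : Code ch E M) :
    ∃ c' : Code ch' E M, c'.errorProb = c.errorProb := by
  classical
  refine ⟨⟨fun m => eIn (c.enc m), fun k y => c.dec k ((eOut k).symm y)⟩, ?_⟩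
  unfold Code.errorProb
  congr 1
  refine Finset.sum_congr rfl fun m _ => ?_
  rw [← Equiv.sum_comp (Equiv.piCongrRight eOut)]
  refine Finset.sum_congr rfl fun y _ => ?_
  have := hlaw (c.enc m) y
  simp only [Equiv.piCongrRight_apply, Pi.map_apply, Equiv.symm_apply_apply]
  rw [← this]
  rfl

/-- Achievability only depends on the channels up to relabelling. -/
theorem Achievable.relabel {K : ℕ} {net net' : ℕ → BroadcastChannel K}
    {E : Finset (Finset (Fin K))} {R : E → ℝ} (eIn : ∀ n, (net n).In ≃ (net' n).In)
    (eOut : ∀ n k, (net n).Out k ≃ (net' n).Out k)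
    (hlaw : ∀ n x y, (net' n).law (eIn n x) (fun k => eOut n k (y k)) = (net n).law x y)
    (h : Achievable net E R) : Achievable net' E R := by
  obtain ⟨h0, c, hc⟩ := h
  choose c' hc' using fun n => (c n).exists_relabel (eIn n) (eOut n) (hlaw n)
  exact ⟨h0, c', by simpa only [hc'] using hc⟩

theorem capacityRegion_congr {K : ℕ} {net net' : ℕ → BroadcastChannel K}
    {E : Finset (Finset (Fin K))} (eIn : ∀ n, (net n).In ≃ (net' n).In)
    (eOut : ∀ n k, (net n).Out k ≃ (net' n).Out k)
    (hlaw : ∀ n x y, (net' n).law (eIn n x) (fun k => eOut n k (y k)) = (net n).law x y) :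
    capacityRegion net E = capacityRegion net' E := by
  unfold capacityRegion
  congr 1
  ext R
  refine ⟨Achievable.relabel eIn eOut hlaw, Achievable.relabel (fun n => (eIn n).symm)
    (fun n k => (eOut n k).symm) fun n x y => ?_⟩
  rw [← hlaw]
  simp

/-- What receiver `k` sees of the input `x`. -/
def observe {K : ℕ} {w : Finset (Fin K) → ℕ} (k : Fin K) (x : ∀ S : P K, Fin (w S.1)) :
    ∀ S : W k (P K), Fin (w S.1) :=
  fun S => x ⟨S.1, W_subset S.2⟩

open Classical in
theorem combChannel_law {K : ℕ} {w : Finset (Fin K) → ℕ} (x : ∀ S : P K, Fin (w S.1))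
    (y : ∀ k, ∀ S : W k (P K), Fin (w S.1)) :
    (combChannel w).law x y = if y = (fun k => observe k x) then 1 else 0 := rfl

/-- A block of `n` families of symbols is a family of blocks of `n` symbols. -/
def blockEquiv {ι : Type} (v : ι → ℕ) (n : ℕ) :
    (Fin n → ∀ i : ι, Fin (v i)) ≃ ∀ i : ι, Fin (v i ^ n) :=
  (Equiv.piComm fun (_ : Fin n) (i : ι) => Fin (v i)).trans
    (Equiv.piCongrRight fun _ => finFunctionFinEquiv)

open Classical in
theorem combDMBC_law {K : ℕ} {v : Finset (Fin K) → ℕ} {n : ℕ}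
    (x : Fin n → ∀ S : P K, Fin (v S.1)) (y : ∀ k, Fin n → ∀ S : W k (P K), Fin (v S.1)) :
    (combDMBC v n).law x y = if ∀ k t, y k t = observe k (x t) then 1 else 0 := by
  have hpow : (combDMBC v n).law x y =
      ∏ t : Fin n, (combChannel v).law (x t) (fun k => y k t) := rfl
  rw [hpow, Finset.prod_congr rfl fun t _ => combChannel_law (x t) (fun k => y k t),
    Finset.prod_ite_zero]
  simp only [Finset.prod_const_one, Finset.mem_univ, true_imp_iff, funext_iff (f := fun k => y k _)]
  exact if_congr forall_comm rfl rfl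

theorem combChannel_law_blockEquiv {K : ℕ} {v : Finset (Fin K) → ℕ} {n : ℕ}
    (x : Fin n → ∀ S : P K, Fin (v S.1)) (y : ∀ k, Fin n → ∀ S : W k (P K), Fin (v S.1)) :
    (combChannel fun S => v S ^ n).law (blockEquiv (fun S : P K => v S.1) n x)
      (fun k => blockEquiv (fun S : W k (P K) => v S.1) n (y k)) = (combDMBC v n).law x y := by
  rw [combDMBC_law]
  refine (combChannel_law _ _).trans (if_congr ?_ rfl rfl)
  have key : ∀ k, observe k (w := fun S => v S ^ n) (blockEquiv (fun S : P K => v S.1) n x)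
      = blockEquiv (fun S : W k (P K) => v S.1) n (fun t => observe k (x t)) := fun _ => rfl
  rw [funext_iff]
  refine forall_congr' fun k => ?_
  rw [key, Equiv.apply_eq_iff_eq, funext_iff]

theorem capacityRegion_combDMBC {K : ℕ} (v : Finset (Fin K) → ℕ) (E : Finset (Finset (Fin K))) :
    capacityRegion (combDMBC v) E
      = capacityRegion (fun n => combChannel fun S => v S ^ n) E :=
  capacityRegion_congr (fun n => blockEquiv (fun S : P K => v S.1) n)
    (fun n k => blockEquiv (fun S : W k (P K) => v S.1) n)
    fun _ x y => combChannel_law_blockEquiv x y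

/-! ### Codes for the noiseless channel -/

theorem observe_eq_iff {K : ℕ} {w : Finset (Fin K) → ℕ} {k : Fin K}
    {x x' : ∀ S : P K, Fin (w S.1)} :
    observe k x = observe k x' ↔ ∀ S : P K, k ∈ S.1 → x S = x' S := by
  constructor
  · intro h S hS
    exact congrFun h ⟨S.1, Finset.mem_filter.2 ⟨S.2, hS⟩⟩
  · intro h
    funext S
    exact h ⟨S.1, W_subset S.2⟩ (Finset.mem_filter.1 S.2).2

/-- All receivers decode the message tuple `m` correctly. -/
def Code.Correct {K : ℕ} {w : Finset (Fin K) → ℕ} {E : Finset (Finset (Fin K))} {M : E → ℕ}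
    (c : Code (combChannel w) E M) (m : ∀ S : E, Fin (M S)) : Prop :=
  ∀ k, c.dec k (observe k (c.enc m)) = fun S : W k E => m ⟨S.1, W_subset S.2⟩

open Classical in
theorem Code.errorProb_combChannel {K : ℕ} {w : Finset (Fin K) → ℕ}
    {E : Finset (Finset (Fin K))} {M : E → ℕ} (c : Code (combChannel w) E M) :
    c.errorProb = (Finset.univ.filter fun m => ¬ c.Correct m).card
      / (Fintype.card (∀ S : E, Fin (M S)) : ℝ) := by
  unfold Code.errorProb
  congr 1
  rw [Finset.card_filter, Nat.cast_sum]
  refine Finset.sum_congr rfl fun m _ => ?_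
  refine (Finset.sum_eq_single (fun k => observe k (c.enc m)) ?_ ?_).trans ?_
  rotate_left 2
  · have : (combChannel w).law (c.enc m) (fun k => observe k (c.enc m)) = 1 := if_pos rfl
    rw [this, one_mul]
    by_cases h : c.Correct m
    · rw [if_neg (not_not.2 h), Nat.cast_zero]
      exact if_pos h
    · rw [if_pos h, Nat.cast_one]
      exact if_neg h
  · intro y _ hy
    have : (combChannel w).law (c.enc m) y = 0 := if_neg hy
    rw [this, zero_mul]
  · intro h
    exact absurd (Finset.mem_univ _) h

open Classical in
/-- Every encoder has decoders that only fail if some receiver cannot tell its messages apart. -/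
theorem exists_code_of_enc {K : ℕ} {w : Finset (Fin K) → ℕ} {E : Finset (Finset (Fin K))}
    {M : E → ℕ} (hM : ∀ S, 0 < M S) (enc : (∀ S : E, Fin (M S)) → ∀ S : P K, Fin (w S.1)) :
    ∃ c : Code (combChannel w) E M, c.errorProb ≤
      (Finset.univ.filter fun m => ∃ k m', observe k (enc m) = observe k (enc m') ∧
        ∃ S : E, k ∈ S.1 ∧ m' S ≠ m S).card / (Fintype.card (∀ S : E, Fin (M S)) : ℝ) := by
  refine ⟨⟨enc, fun k y S => if h : ∃ m', observe k (enc m') = y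
    then h.choose ⟨S.1, W_subset S.2⟩ else ⟨0, hM _⟩⟩, ?_⟩
  rw [Code.errorProb_combChannel]
  gcongr with m
  intro hm
  unfold Code.Correct at hm
  push Not at hm
  obtain ⟨k, hk⟩ := hm
  have hex : ∃ m', observe k (enc m') = observe k (enc m) := ⟨m, rfl⟩
  simp only [dif_pos hex] at hk
  obtain ⟨S, hS⟩ := Function.ne_iff.1 hk
  exact ⟨k, hex.choose, hex.choose_spec.symm, ⟨S.1, W_subset S.2⟩, (Finset.mem_filter.1 S.2).2, hS⟩

end CombNet

namespace CombNet

/-! ### Counting arguments -/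

section Counting

variable {Ω A B D F : Type*} [Fintype B] [Fintype F] {G : Finset Ω}
  {u : Ω → A} {v : Ω → B}

theorem card_le_of_separates {f : Ω → F} (hf : ∀ m ∈ G, ∀ m' ∈ G, f m = f m' → m = m') :
    G.card ≤ Fintype.card F :=
  Finset.card_le_card_of_injOn f (fun _ _ => Finset.mem_univ _) fun m hm m' hm' h =>
    hf m hm m' hm' h

theorem card_le_of_separates_fst (huv : ∀ m m', u m = u m' → v m = v m' → m = m') {f : Ω → F}
    (hf : ∀ m ∈ G, ∀ m' ∈ G, f m = f m' → u m = u m') :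
    G.card ≤ Fintype.card B * Fintype.card F := by
  rw [← Fintype.card_prod]
  refine card_le_of_separates (f := fun m => (v m, f m)) fun m hm m' hm' h => ?_
  rw [Prod.mk.injEq] at h
  exact huv _ _ (hf m hm m' hm' h.2) h.1

theorem sum_card_image_fiber_le [Fintype A] [DecidableEq A] [DecidableEq F] {f : Ω → F}
    (hf : ∀ m ∈ G, ∀ m' ∈ G, f m = f m' → u m = u m') :
    ∑ a, ((G.filter fun m => u m = a).image f).card ≤ Fintype.card F := by
  rw [← Finset.card_biUnion]
  · exact Finset.card_le_univ _
  · intro a _ a' _ haa'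
    rw [Function.onFun, Finset.disjoint_left]
    intro y hy hy'
    obtain ⟨m, hm, rfl⟩ := Finset.mem_image.1 hy
    obtain ⟨m', hm', h⟩ := Finset.mem_image.1 hy'
    rw [Finset.mem_filter] at hm hm'
    exact haa' (hm.2.symm.trans ((hf _ hm.1 _ hm'.1 h.symm).trans hm'.2))

/-- If each of `f₁` and `f₂` determines the component `u` of a pair `(u, v)` in `G`, and `f₁`, `f₂`,
`g` together determine the pair, then `|G|²` is at most the product of the sizes of the ranges
of `v`, `g`, `f₁` and `f₂`. -/
theorem sq_card_le_of_separates {F₁ F₂ : Type*} [Fintype A] [Fintype D] [Fintype F₁] [Fintype F₂]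
    (huv : ∀ m m', u m = u m' → v m = v m' → m = m') {f₁ : Ω → F₁} {f₂ : Ω → F₂} {g : Ω → D}
    (h₁ : ∀ m ∈ G, ∀ m' ∈ G, f₁ m = f₁ m' → u m = u m')
    (h₂ : ∀ m ∈ G, ∀ m' ∈ G, f₂ m = f₂ m' → u m = u m')
    (hg : ∀ m ∈ G, ∀ m' ∈ G, f₁ m = f₁ m' → f₂ m = f₂ m' → g m = g m' → m = m') :
    G.card ^ 2 ≤ Fintype.card B * Fintype.card D * Fintype.card F₁ * Fintype.card F₂ := by
  classical
  set H : A → Finset Ω := fun a => G.filter fun m => u m = a with hH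
  have hsum : ∑ a, (H a).card = G.card :=
    (Finset.card_eq_sum_card_fiberwise fun m _ => Finset.mem_univ (u m)).symm
  have hB : ∀ a, (H a).card ≤ Fintype.card B := fun a =>
    card_le_of_separates (f := v) fun m hm m' hm' h => by
      rw [Finset.mem_filter] at hm hm'
      exact huv _ _ (hm.2.trans hm'.2.symm) h
  have hprod : ∀ a, (H a).card ≤
      Fintype.card D * ((H a).image f₁).card * ((H a).image f₂).card := fun a => by
    rw [← Finset.card_univ, ← Finset.card_product, ← Finset.card_product]
    refine Finset.card_le_card_of_injOn (fun m => ((g m, f₁ m), f₂ m)) (fun m hm => ?_)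
      fun m hm m' hm' h => ?_
    · simp only [Finset.coe_product, Set.mem_prod, Finset.mem_coe]
      exact ⟨⟨Finset.mem_univ _, Finset.mem_image_of_mem _ hm⟩, Finset.mem_image_of_mem _ hm⟩
    · simp only [Prod.mk.injEq] at h
      exact hg m (Finset.mem_filter.1 hm).1 m' (Finset.mem_filter.1 hm').1 h.1.2 h.2 h.1.1
  calc G.card ^ 2 = (∑ a, (H a).card) ^ 2 := by rw [hsum]
    _ ≤ (∑ a, Fintype.card B * Fintype.card D * ((H a).image f₁).card) *
        ∑ a, ((H a).image f₂).card := by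
        refine Finset.sum_sq_le_sum_mul_sum_of_sq_le_mul _ (fun _ _ => Nat.zero_le _)
          (fun _ _ => Nat.zero_le _) fun a _ => ?_
        calc (H a).card ^ 2 = (H a).card * (H a).card := sq _
          _ ≤ Fintype.card B *
              (Fintype.card D * ((H a).image f₁).card * ((H a).image f₂).card) :=
            Nat.mul_le_mul (hB a) (hprod a)
          _ = _ := by ring
    _ ≤ _ := by
        rw [← Finset.mul_sum]
        gcongr
        · exact sum_card_image_fiber_le h₁
        · exact sum_card_image_fiber_le h₂

end Counting

/-! ### The two messages -/

variable {K : ℕ}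

/-- The index of the common message. -/
abbrev idxC (K : ℕ) : nested K := ⟨Finset.univ, by simp [nested]⟩

/-- The index of the private message. -/
abbrev idxP (K : ℕ) : nested K := ⟨privRecv K, by simp [nested]⟩

theorem mem_privRecv {k : Fin K} : k ∈ privRecv K ↔ k ∉ commonRecv K := by
  simp [privRecv]

theorem eq_idxC_or_eq_idxP (S : nested K) : S = idxC K ∨ S = idxP K := by
  have := S.2
  simp only [nested, Finset.mem_insert, Finset.mem_singleton] at this
  rcases this with h | h
  · exact Or.inr (Subtype.ext h)
  · exact Or.inl (Subtype.ext h)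

theorem exists_commonRecv_eq (hK : 2 ≤ K) : ∃ p q : Fin K, p ≠ q ∧ commonRecv K = {p, q} := by
  refine ⟨⟨K - 2, by omega⟩, ⟨K - 1, by omega⟩, ?_, ?_⟩
  · rw [Ne, Fin.mk.injEq]
    omega
  · ext i
    have := i.2
    simp only [commonRecv, Finset.mem_filter, Finset.mem_univ, true_and, Finset.mem_insert,
      Finset.mem_singleton, Fin.ext_iff]
    omega

theorem privRecv_nonempty (hK : 3 ≤ K) : (privRecv K).Nonempty :=
  ⟨⟨0, by omega⟩, by simp [mem_privRecv, commonRecv]; omega⟩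

theorem idxC_ne_idxP (hK : 2 ≤ K) : idxC K ≠ idxP K := by
  intro h
  have h1 : Finset.univ = privRecv K := congrArg Subtype.val h
  have h2 : (⟨K - 1, by omega⟩ : Fin K) ∈ privRecv K := h1 ▸ Finset.mem_univ _
  rw [mem_privRecv] at h2
  refine h2 ?_
  simp only [commonRecv, Finset.mem_filter, Finset.mem_univ, true_and]
  omega

theorem message_ext {M : nested K → ℕ} {m m' : ∀ S, Fin (M S)} (hc : m (idxC K) = m' (idxC K))
    (hp : m (idxP K) = m' (idxP K)) : m = m' := by
  funext S
  rcases eq_idxC_or_eq_idxP S with rfl | rfl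
  · exact hc
  · exact hp

theorem card_message (hK : 2 ≤ K) (M : nested K → ℕ) :
    Fintype.card (∀ S, Fin (M S)) = M (idxC K) * M (idxP K) := by
  classical
  rw [Fintype.card_pi]
  simp only [Fintype.card_fin]
  have : (Finset.univ : Finset (nested K)) = {idxC K, idxP K} := by
    ext S
    simpa using eq_idxC_or_eq_idxP S
  rw [this, Finset.prod_pair (idxC_ne_idxP hK)]

/-! ### The converse for a single code -/

/-- The number of values of the family of links `F`, as a real number. -/
noncomputable def numVals (w : Finset (Fin K) → ℕ) (F : Finset (Finset (Fin K))) : ℝ :=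
  ∏ S ∈ F, (w S : ℝ)

theorem card_pi_links (w : Finset (Fin K) → ℕ) (F : Finset (Finset (Fin K))) :
    (Fintype.card (∀ S : F, Fin (w S.1)) : ℝ) = numVals w F := by
  rw [Fintype.card_pi]
  simp only [Fintype.card_fin, Nat.cast_prod]
  exact Finset.prod_coe_sort F fun S => (w S : ℝ)

theorem Code.Correct.eq_idxC {w : Finset (Fin K) → ℕ} {M : nested K → ℕ}
    {c : Code (combChannel w) (nested K) M} {m m' : ∀ S, Fin (M S)} (h : c.Correct m)
    (h' : c.Correct m') {k : Fin K} (hk : observe k (c.enc m) = observe k (c.enc m')) :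
    m (idxC K) = m' (idxC K) := by
  have e := (h k).symm.trans ((congrArg (c.dec k) hk).trans (h' k))
  exact congrFun e ⟨Finset.univ, Finset.mem_filter.2 ⟨(idxC K).2, Finset.mem_univ k⟩⟩

theorem Code.Correct.eq_of_mem_privRecv {w : Finset (Fin K) → ℕ} {M : nested K → ℕ}
    {c : Code (combChannel w) (nested K) M} {m m' : ∀ S, Fin (M S)} (h : c.Correct m)
    (h' : c.Correct m') {k : Fin K} (hk : observe k (c.enc m) = observe k (c.enc m'))
    (hkp : k ∈ privRecv K) : m = m' := by
  have e := (h k).symm.trans ((congrArg (c.dec k) hk).trans (h' k))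
  exact message_ext (h.eq_idxC h' hk)
    (congrFun e ⟨privRecv K, Finset.mem_filter.2 ⟨(idxP K).2, hkp⟩⟩)

theorem downIn_subset_P {Q F : Finset (Finset (Fin K))} : downIn F Q ⊆ P K :=
  Finset.inter_subset_left.trans (Finset.filter_subset _ _)

theorem mem_downIn_privRecv {j : Fin K} {S : Finset (Fin K)} :
    S ∈ downIn (W j (P K)) {privRecv K} ↔ S ∈ W j (P K) ∧ ∀ i ∈ commonRecv K, i ∉ S := by
  simp only [downIn, down, W, Finset.mem_inter, Finset.mem_filter, Finset.mem_singleton,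
    exists_eq_left, Finset.subset_iff, mem_privRecv]
  constructor
  · rintro ⟨⟨_, h⟩, h'⟩
    exact ⟨h', fun i hi hiS => h hiS hi⟩
  · rintro ⟨h', h⟩
    exact ⟨⟨h'.1, fun i hiS hi => h i hi hiS⟩, h'⟩

/-- Bounds on the numbers of messages of a code whose error probability is at most one half. -/
theorem Code.message_bounds (hK : 2 ≤ K) {w : Finset (Fin K) → ℕ} {M : nested K → ℕ}
    (hM : ∀ S, 0 < M S) (c : Code (combChannel w) (nested K) M) (hc : c.errorProb ≤ 1 / 2) :
    (∀ i, (M (idxC K) : ℝ) ≤ 2 * numVals w (W i (P K))) ∧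
    (∀ j ∈ privRecv K, (M (idxC K) : ℝ) * M (idxP K) ≤ 2 * numVals w (W j (P K))) ∧
    (∀ j ∈ privRecv K, (M (idxC K) : ℝ) ^ 2 * M (idxP K) ≤
      4 * (numVals w (downIn (W j (P K)) {privRecv K}) *
        ∏ i ∈ commonRecv K, numVals w (W i (P K)))) := by
  classical
  set G := Finset.univ.filter fun m => c.Correct m with hG
  have hα : (0 : ℝ) < M (idxC K) := Nat.cast_pos.2 (hM _)
  have hβ : (0 : ℝ) < M (idxP K) := Nat.cast_pos.2 (hM _)
  have hcard : (M (idxC K) : ℝ) * M (idxP K) ≤ 2 * G.card := by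
    have h1 := Finset.card_filter_add_card_filter_not (s := Finset.univ) (fun m => c.Correct m)
    rw [Finset.card_univ, card_message hK] at h1
    rw [Code.errorProb_combChannel, card_message hK, div_le_iff₀ (by push_cast; positivity)] at hc
    have h2 : (G.card : ℝ) + (Finset.univ.filter fun m => ¬ c.Correct m).card =
        M (idxC K) * M (idxP K) := by exact_mod_cast h1
    push_cast at hc
    linarith
  have hmem : ∀ {m}, m ∈ G → c.Correct m := fun hm => (Finset.mem_filter.1 hm).2
  refine ⟨fun i => ?_, fun j hj => ?_, fun j hj => ?_⟩
  · have h := card_le_of_separates_fst (G := G) (u := fun m => m (idxC K))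
      (v := fun m => m (idxP K)) (fun m m' => message_ext)
      (f := fun m => observe i (c.enc m)) fun m hm m' hm' h => (hmem hm).eq_idxC (hmem hm') h
    have h' : (G.card : ℝ) ≤ M (idxP K) * numVals w (W i (P K)) := by
      rw [← card_pi_links]
      simpa using (Nat.cast_le (α := ℝ)).2 h
    nlinarith
  · have h := card_le_of_separates (G := G) (f := fun m => observe j (c.enc m))
      fun m hm m' hm' h => (hmem hm).eq_of_mem_privRecv (hmem hm') h hj
    have h' : (G.card : ℝ) ≤ numVals w (W j (P K)) := by
      rw [← card_pi_links]
      exact (Nat.cast_le (α := ℝ)).2 h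
    linarith
  · obtain ⟨p, q, hpq, hcr⟩ := exists_commonRecv_eq hK
    have h := sq_card_le_of_separates (G := G) (u := fun m => m (idxC K))
      (v := fun m => m (idxP K)) (fun m m' => message_ext)
      (f₁ := fun m => observe p (c.enc m)) (f₂ := fun m => observe q (c.enc m))
      (g := fun m (S : (downIn (W j (P K)) {privRecv K} : Finset (Finset (Fin K)))) =>
        (show ∀ S : P K, Fin (w S.1) from c.enc m) ⟨S.1, downIn_subset_P S.2⟩)
      (fun m hm m' hm' h => (hmem hm).eq_idxC (hmem hm') h)
      (fun m hm m' hm' h => (hmem hm).eq_idxC (hmem hm') h)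
      (fun m hm m' hm' hp hq hd => by
        refine (hmem hm).eq_of_mem_privRecv (hmem hm') (k := j) ?_ hj
        refine observe_eq_iff.2 fun S hS => ?_
        by_cases hpS : p ∈ S.1
        · exact observe_eq_iff.1 hp S hpS
        by_cases hqS : q ∈ S.1
        · exact observe_eq_iff.1 hq S hqS
        · refine congrFun hd ⟨S.1, mem_downIn_privRecv.2 ⟨Finset.mem_filter.2 ⟨S.2, hS⟩, ?_⟩⟩
          simp [hcr, hpS, hqS])
    have h' : (G.card : ℝ) ^ 2 ≤ M (idxP K) * numVals w (downIn (W j (P K)) {privRecv K}) *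
        numVals w (W p (P K)) * numVals w (W q (P K)) := by
      simp only [← card_pi_links]
      rw [Fintype.card_fin] at h
      exact_mod_cast h
    rw [hcr, Finset.prod_pair hpq]
    have h2 : ((M (idxC K) : ℝ) * M (idxP K)) ^ 2 ≤ (2 * G.card) ^ 2 := by gcongr
    refine le_of_mul_le_mul_left ?_ hβ
    nlinarith

end CombNet

namespace CombNet

/-! ### Exponential growth rates -/

theorem le_two_mul_floor {x : ℝ} (hx : 1 ≤ x) : x ≤ 2 * (⌊x⌋₊ : ℝ) := by
  have h1 : (1 : ℝ) ≤ ⌊x⌋₊ := by exact_mod_cast Nat.one_le_floor_iff x |>.2 hx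
  have h2 := Nat.lt_floor_add_one x
  linarith

theorem one_le_two_rpow (n : ℕ) {r : ℝ} (hr : 0 ≤ r) : 1 ≤ (2 : ℝ) ^ ((n : ℝ) * r) :=
  Real.one_le_rpow one_le_two (by positivity)

theorem floor_two_rpow_pos (n : ℕ) {r : ℝ} (hr : 0 ≤ r) : 0 < ⌊(2 : ℝ) ^ ((n : ℝ) * r)⌋₊ :=
  Nat.floor_pos.2 (one_le_two_rpow n hr)

theorem two_rpow_nat_mul (n : ℕ) (r : ℝ) : (2 : ℝ) ^ ((n : ℝ) * r) = ((2 : ℝ) ^ r) ^ n := by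
  rw [mul_comm, Real.rpow_mul zero_le_two, Real.rpow_natCast]

theorem le_of_eventually_two_rpow_le {a b c : ℝ}
    (h : ∀ᶠ n : ℕ in atTop, (2 : ℝ) ^ ((n : ℝ) * a) ≤ c * 2 ^ ((n : ℝ) * b)) : a ≤ b := by
  by_contra! hab
  have ht : Tendsto (fun n : ℕ => (2 : ℝ) ^ ((n : ℝ) * (a - b))) atTop atTop := by
    simp only [two_rpow_nat_mul]
    exact tendsto_pow_atTop_atTop_of_one_lt
      (Real.one_lt_rpow one_lt_two (sub_pos.2 hab))
  obtain ⟨n, h1, h2⟩ := (h.and (ht.eventually_gt_atTop c)).exists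
  have h3 : (0 : ℝ) < 2 ^ ((n : ℝ) * b) := by positivity
  have h4 : (2 : ℝ) ^ ((n : ℝ) * a) = 2 ^ ((n : ℝ) * (a - b)) * 2 ^ ((n : ℝ) * b) := by
    rw [← Real.rpow_add two_pos]
    ring_nf
  rw [h4] at h1
  exact absurd (le_of_mul_le_mul_right h1 h3) (not_le.2 h2)

variable {K : ℕ}

/-- In block length `n` the link to `V_S` carries one of `w n S` values, where `w n S` is
`2 ^ (n C_S)` up to a factor of two. -/
structure LinkSizes (C : Finset (Fin K) → ℝ) (w : ℕ → Finset (Fin K) → ℕ) : Prop where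
  le : ∀ n : ℕ, ∀ S ∈ P K, (w n S : ℝ) ≤ 2 ^ ((n : ℝ) * C S)
  ge : ∀ n : ℕ, ∀ S ∈ P K, (2 : ℝ) ^ ((n : ℝ) * C S) ≤ 2 * w n S

theorem two_rpow_cap (C : Finset (Fin K) → ℝ) (n : ℕ) (F : Finset (Finset (Fin K))) :
    (2 : ℝ) ^ ((n : ℝ) * cap C F) = ∏ S ∈ F, (2 : ℝ) ^ ((n : ℝ) * C S) := by
  rw [cap, Finset.mul_sum, Real.rpow_sum_of_pos two_pos]

theorem LinkSizes.numVals_le {C : Finset (Fin K) → ℝ} {w : ℕ → Finset (Fin K) → ℕ}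
    (h : LinkSizes C w) {F : Finset (Finset (Fin K))} (hF : F ⊆ P K) (n : ℕ) :
    numVals (w n) F ≤ 2 ^ ((n : ℝ) * cap C F) := by
  rw [two_rpow_cap, numVals]
  exact Finset.prod_le_prod (fun _ _ => Nat.cast_nonneg _) fun S hS => h.le n S (hF hS)

/-! ### The converse -/

theorem Achievable.mem_region (hK : 2 ≤ K) {C : Finset (Fin K) → ℝ}
    {w : ℕ → Finset (Fin K) → ℕ} (hw : LinkSizes C w) {R : nested K → ℝ}
    (h : Achievable (fun n => combChannel (w n)) (nested K) R) : R ∈ region C := by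
  obtain ⟨h0, c, hc⟩ := h
  have hev : ∀ᶠ n in atTop, (c n).errorProb ≤ 1 / 2 := hc.eventually_le_const (by norm_num)
  have hM : ∀ (n : ℕ) S, (2 : ℝ) ^ ((n : ℝ) * R S) ≤ 2 * ⌊(2 : ℝ) ^ ((n : ℝ) * R S)⌋₊ :=
    fun n S => le_two_mul_floor (one_le_two_rpow n (h0 S))
  have hbd := hev.mono fun n hn =>
    (c n).message_bounds hK (fun S => floor_two_rpow_pos n (h0 S)) hn
  refine ⟨h0 _, h0 _, fun i _ => ?_, fun j hj => ?_, fun j hj => ?_⟩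
  · refine le_of_eventually_two_rpow_le (c := 4) (hbd.mono fun n hn => ?_)
    have h1 := hn.1 i
    have h2 := hw.numVals_le (F := W i (P K)) W_subset n
    have h3 := hM n (idxC K)
    unfold rateC
    linarith
  · refine le_of_eventually_two_rpow_le (c := 8) (hbd.mono fun n hn => ?_)
    have h1 := hn.2.1 j hj
    have h2 := hw.numVals_le (F := W j (P K)) W_subset n
    have h3 := mul_le_mul (hM n (idxC K)) (hM n (idxP K)) (by positivity) (by positivity)
    unfold rateC rateP
    rw [mul_add, Real.rpow_add two_pos]
    linarith
  · refine le_of_eventually_two_rpow_le (c := 32) (hbd.mono fun n hn => ?_)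
    have h1 := hn.2.2 j hj
    have h2 : numVals (w n) (downIn (W j (P K)) {privRecv K}) *
        ∏ i ∈ commonRecv K, numVals (w n) (W i (P K)) ≤
        2 ^ ((n : ℝ) * (cap C (downIn (W j (P K)) {privRecv K}) +
          ∑ i ∈ commonRecv K, cap C (W i (P K)))) := by
      rw [mul_add, Real.rpow_add two_pos, Finset.mul_sum, Real.rpow_sum_of_pos two_pos]
      have hnn : ∀ F, 0 ≤ numVals (w n) F := fun F => Finset.prod_nonneg fun _ _ => Nat.cast_nonneg _
      exact mul_le_mul (hw.numVals_le downIn_subset_P n)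
        (Finset.prod_le_prod (fun _ _ => hnn _) fun i _ => hw.numVals_le W_subset n)
        (Finset.prod_nonneg fun _ _ => hnn _) (by positivity)
    have h3 := mul_le_mul (mul_le_mul (hM n (idxC K)) (hM n (idxC K)) (by positivity)
      (by positivity)) (hM n (idxP K)) (by positivity) (by positivity)
    unfold rateC rateP
    rw [mul_add, two_mul (R _), mul_add, Real.rpow_add two_pos, Real.rpow_add two_pos]
    linarith

theorem isClosed_region (C : Finset (Fin K) → ℝ) : IsClosed (region C) := by
  have hc : Continuous fun R : nested K → ℝ => rateC R := continuous_apply _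
  have hp : Continuous fun R : nested K → ℝ => rateP R := continuous_apply _
  have hset : region C = {R | 0 ≤ rateC R} ∩ ({R | 0 ≤ rateP R} ∩
      ((⋂ i ∈ commonRecv K, {R | rateC R ≤ cap C (W i (P K))}) ∩
      ((⋂ j ∈ privRecv K, {R | rateC R + rateP R ≤ cap C (W j (P K))}) ∩
      ⋂ j ∈ privRecv K, {R | 2 * rateC R + rateP R ≤
        cap C (downIn (W j (P K)) {privRecv K}) + ∑ i ∈ commonRecv K, cap C (W i (P K))}))) := by
    ext R
    simp [region]
  rw [hset]
  refine (isClosed_le continuous_const hc).inter ((isClosed_le continuous_const hp).inter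
    (IsClosed.inter ?_ (IsClosed.inter ?_ ?_))) <;>
  refine isClosed_biInter fun i _ => isClosed_le (by fun_prop) continuous_const

theorem capacityRegion_subset_region (hK : 2 ≤ K) {C : Finset (Fin K) → ℝ}
    {w : ℕ → Finset (Fin K) → ℕ} (hw : LinkSizes C w) :
    capacityRegion (fun n => combChannel (w n)) (nested K) ⊆ region C :=
  closure_minimal (fun _ h => Achievable.mem_region hK hw h) (isClosed_region C)

end CombNet

namespace CombNet

open scoped BigOperators

/-! ### Expectations over random functions -/

theorem expect_prod_pi {ι : Type*} [Fintype ι] [DecidableEq ι] {Ω : ι → Type*}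
    [∀ i, Fintype (Ω i)] (F : ∀ i, Ω i → ℝ) :
    𝔼 ω : (∀ i, Ω i), ∏ i, F i (ω i) = ∏ i, 𝔼 x, F i x := by
  simp only [Fintype.expect_eq_sum_div_card, Finset.prod_div_distrib, Fintype.card_pi,
    Nat.cast_prod]
  rw [Finset.prod_univ_sum, Fintype.piFinset_univ]

theorem expect_collision_le {D Y : Type*} [Fintype D] [DecidableEq D] [Fintype Y] [DecidableEq Y]
    [Nonempty Y] (d d' : D) :
    𝔼 g : D → Y, (if g d = g d' then (1 : ℝ) else 0) ≤
      if d = d' then 1 else (Fintype.card Y : ℝ)⁻¹ := by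
  split_ifs with h
  · simp [h]
  · rw [Fintype.expect_eq_sum_div_card, Finset.sum_boole]
    have hY : (0 : ℝ) < Fintype.card Y := Nat.cast_pos.2 Fintype.card_pos
    rw [div_le_iff₀ (Nat.cast_pos.2 Fintype.card_pos), ← div_eq_inv_mul, le_div_iff₀ hY]
    have hle : (((Finset.univ.filter fun g : D → Y => g d = g d') ×ˢ
        (Finset.univ : Finset Y)).card) ≤ (Finset.univ : Finset (D → Y)).card := by
      refine Finset.card_le_card_of_injOn (fun z => Function.update z.1 d z.2)
        (fun _ _ => Finset.mem_univ _) fun z hz z' hz' hzz => ?_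
      simp only [Finset.coe_product, Set.mem_prod, Finset.mem_coe, Finset.mem_filter,
        Finset.mem_univ, true_and, and_true] at hz hz'
      have h1 : z.2 = z'.2 := by simpa using congrFun hzz d
      have h2 : ∀ i, i ≠ d → z.1 i = z'.1 i := fun i hi => by
        simpa [Function.update_of_ne hi] using congrFun hzz i
      refine Prod.ext (funext fun i => ?_) h1
      by_cases hi : i = d
      · rw [hi, hz, hz', h2 d' (Ne.symm h)]
      · exact h2 i hi
    rw [Finset.card_product, Finset.card_univ, Finset.card_univ] at hle
    exact_mod_cast hle

theorem expect_add_collision_mul_le {D Y : Type*} [Fintype D] [DecidableEq D] [Fintype Y]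
    [DecidableEq Y] [Nonempty Y] {d d' : D}
    (h : d ≠ d') (s : ℝ) {t : ℝ} (ht : 0 ≤ t) :
    𝔼 g : D → Y, (s + (if g d = g d' then (1 : ℝ) else 0) * t) ≤
      s + (Fintype.card Y : ℝ)⁻¹ * t := by
  rw [Finset.expect_add_distrib, Fintype.expect_const, ← Finset.expect_mul]
  have := expect_collision_le (Y := Y) d d'
  rw [if_neg h] at this
  gcongr

variable {K : ℕ}

open Classical in
/-- Whether, for the codebooks `G`, the inputs described by `d` and `d'` look the same to `k`. -/
noncomputable def confusion {D : Type*} {w : Finset (Fin K) → ℕ}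
    (G : ∀ S : P K, D → Fin (w S.1)) (k : Fin K) (d d' : Finset (Fin K) → D) : ℝ :=
  if ∀ S : P K, k ∈ S.1 → G S (d S.1) = G S (d' S.1) then 1 else 0

theorem confusion_nonneg {D : Type*} {w : Finset (Fin K) → ℕ}
    (G : ∀ S : P K, D → Fin (w S.1)) (k : Fin K) (d d' : Finset (Fin K) → D) :
    0 ≤ confusion G k d d' := by
  unfold confusion
  split_ifs <;> norm_num

theorem expect_confusion_le {D : Type*} [Fintype D] [DecidableEq D] {w : Finset (Fin K) → ℕ}
    (hw : ∀ S ∈ P K, 0 < w S) (k : Fin K) (d d' : Finset (Fin K) → D) :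
    𝔼 G : (∀ S : P K, D → Fin (w S.1)), confusion G k d d' ≤
      ∏ S ∈ W k (P K), if d S = d' S then 1 else (w S : ℝ)⁻¹ := by
  have h1 : ∀ G : (∀ S : P K, D → Fin (w S.1)), confusion G k d d' =
      ∏ S : P K, if k ∈ S.1 then (if G S (d S.1) = G S (d' S.1) then (1 : ℝ) else 0) else 1 := by
    intro G
    unfold confusion
    by_cases h : ∀ S : P K, k ∈ S.1 → G S (d S.1) = G S (d' S.1)
    · rw [if_pos h, Finset.prod_eq_one]
      intro S _
      split_ifs with h2 h3
      · rfl
      · exact absurd (h S h2) h3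
      · rfl
    · rw [if_neg h]
      push Not at h
      obtain ⟨S, hS, hne⟩ := h
      exact (Finset.prod_eq_zero (Finset.mem_univ S) (by rw [if_pos hS, if_neg hne])).symm
  simp only [h1]
  rw [expect_prod_pi (Ω := fun S : P K => D → Fin (w S.1)) fun S g =>
    if k ∈ S.1 then (if g (d S.1) = g (d' S.1) then (1 : ℝ) else 0) else 1]
  rw [W, Finset.prod_filter, ← Finset.prod_coe_sort (P K)]
  refine Finset.prod_le_prod (fun S _ => Finset.expect_nonneg fun g _ => by
    split_ifs <;> norm_num) fun S _ => ?_
  have : Nonempty (Fin (w S.1)) := ⟨⟨0, hw _ S.2⟩⟩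
  by_cases h2 : k ∈ S.1
  · simp only [if_pos h2]
    have h3 := expect_collision_le (Y := Fin (w S.1)) (d S.1) (d' S.1)
    rw [Fintype.card_fin] at h3
    exact h3
  · simp only [if_neg h2]
    rw [Fintype.expect_const]

/-! ### The random code -/

/-- The links of the family `F` whose membership of the receivers `p` and `q` is as prescribed. -/
def linkClass (F : Finset (Finset (Fin K))) (p q : Fin K) (s t : Bool) :
    Finset (Finset (Fin K)) :=
  F.filter fun S => (p ∈ S ↔ s = true) ∧ (q ∈ S ↔ t = true)

@[to_additive]
theorem prod_linkClass {M : Type*} [CommMonoid M] (F : Finset (Finset (Fin K))) (p q : Fin K)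
    (φ : Finset (Fin K) → M) :
    ∏ S ∈ F, φ S =
      ((∏ S ∈ linkClass F p q true true, φ S) * ∏ S ∈ linkClass F p q true false, φ S) *
      ((∏ S ∈ linkClass F p q false true, φ S) * ∏ S ∈ linkClass F p q false false, φ S) := by
  simp only [linkClass]
  rw [← Finset.prod_filter_mul_prod_filter_not F fun S => p ∈ S,
    ← Finset.prod_filter_mul_prod_filter_not (F.filter fun S => p ∈ S) fun S => q ∈ S,
    ← Finset.prod_filter_mul_prod_filter_not (F.filter fun S => ¬ p ∈ S) fun S => q ∈ S]
  simp [Finset.filter_filter]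

/-- Values of a hash of the private message, of two hashes that may be missing, and of the private
message itself, which may be missing. -/
def Tag (B U X Y : Type*) : Type _ := U × Option X × Option Y × Option B

instance {B U X Y : Type*} [Fintype B] [Fintype U] [Fintype X] [Fintype Y] :
    Fintype (Tag B U X Y) :=
  inferInstanceAs (Fintype (U × Option X × Option Y × Option B))

noncomputable instance {B U X Y : Type*} : DecidableEq (Tag B U X Y) := Classical.decEq _

/-- The tag with the given components. -/
def Tag.mk {B U X Y : Type*} (u : U) (x : Option X) (y : Option Y) (b : Option B) :
    Tag B U X Y := (u, x, y, b)

@[simp]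
theorem Tag.mk_inj {B U X Y : Type*} {u u' : U} {x x' : Option X} {y y' : Option Y}
    {b b' : Option B} : Tag.mk u x y b = Tag.mk u' x' y' b' ↔ u = u' ∧ x = x' ∧ y = y' ∧ b = b' := by
  change ((u, x, y, b) : U × Option X × Option Y × Option B) = (u', x', y', b') ↔ _
  simp only [Prod.mk.injEq]

/-- What the link to `V_S` may depend on, apart from the common message: the first hash of the
private message, the second unless `q ∈ S`, the third unless `p ∈ S`, and the private message
itself if `S` contains neither `p` nor `q`. -/
def tag {B U X Y : Type*} (p q : Fin K) (f : B → U) (g : B → X) (h : B → Y) (S : Finset (Fin K))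
    (b : B) : Tag B U X Y :=
  .mk (f b) (if q ∈ S then none else some (g b)) (if p ∈ S then none else some (h b))
    (if p ∈ S ∨ q ∈ S then none else some b)

section Weight

variable {B U X Y : Type*}

/-- The probability that random codebooks cannot separate the private messages `b` and `b'` at
the receiver `k`. -/
noncomputable def tagWeight (w : Finset (Fin K) → ℕ) (p q k : Fin K) (f : B → U) (g : B → X)
    (h : B → Y) (b b' : B) : ℝ :=
  ∏ S ∈ W k (P K), if tag p q f g h S b = tag p q f g h S b' then 1 else (w S : ℝ)⁻¹

/-- The probability that random symbols on the links of `W k (P K)` in a given class coincide. -/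
noncomputable def classProb (w : Finset (Fin K) → ℕ) (p q k : Fin K) (s t : Bool) : ℝ :=
  (numVals w (linkClass (W k (P K)) p q s t))⁻¹

/-- An upper bound for the mean of `tagWeight` when the three hashes are random. -/
noncomputable def meanWeight (w : Finset (Fin K) → ℕ) (p q k : Fin K) (U X Y : Type*) [Fintype U]
    [Fintype X] [Fintype Y] : ℝ :=
  let r := classProb w p q k
  r true true * r true false * r false true * r false false
    + (Fintype.card U : ℝ)⁻¹ * (r true false * r false true * r false false
      + (Fintype.card X : ℝ)⁻¹ * (r false true * r false false)
      + (Fintype.card Y : ℝ)⁻¹ * (r true false * r false false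
        + (Fintype.card X : ℝ)⁻¹ * r false false))

theorem numVals_nonneg (w : Finset (Fin K) → ℕ) (F : Finset (Finset (Fin K))) :
    0 ≤ numVals w F :=
  Finset.prod_nonneg fun _ _ => Nat.cast_nonneg _

theorem tagWeight_le [DecidableEq U] [DecidableEq X] [DecidableEq Y]
    (w : Finset (Fin K) → ℕ) (p q k : Fin K) (f : B → U) (g : B → X)
    (h : B → Y) {b b' : B} (hb : b ≠ b') {r : Bool → Bool → ℝ}
    (hr_def : r = classProb w p q k) :
    tagWeight w p q k f g h b b' ≤
      r true true * r true false * r false true * r false false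
        + (if f b = f b' then 1 else 0) * (r true false * r false true * r false false
          + (if g b = g b' then 1 else 0) * (r false true * r false false)
          + (if h b = h b' then 1 else 0) * (r true false * r false false
            + (if g b = g b' then 1 else 0) * r false false)) := by
  have hr : ∀ s t, 0 ≤ r s t := fun s t => hr_def ▸ inv_nonneg.2 (numVals_nonneg _ _)
  have hprod : ∀ (s t : Bool) (Q : Prop) [Decidable Q],
      (∀ S, (p ∈ S ↔ s = true) → (q ∈ S ↔ t = true) →
        (tag p q f g h S b = tag p q f g h S b' ↔ Q)) →
      ∏ S ∈ linkClass (W k (P K)) p q s t,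
        (if tag p q f g h S b = tag p q f g h S b' then 1 else (w S : ℝ)⁻¹) =
      if Q then 1 else r s t := by
    intro s t Q _ hQ
    by_cases hQ' : Q
    · rw [if_pos hQ']
      refine Finset.prod_eq_one fun S hS => ?_
      have hS' := (Finset.mem_filter.1 hS).2
      rw [if_pos ((hQ S hS'.1 hS'.2).2 hQ')]
    · rw [if_neg hQ']
      simp only [hr_def, classProb, numVals]
      rw [← Finset.prod_inv_distrib]
      refine Finset.prod_congr rfl fun S hS => ?_
      have hS' := (Finset.mem_filter.1 hS).2
      rw [if_neg fun h => hQ' ((hQ S hS'.1 hS'.2).1 h)]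
  unfold tagWeight
  rw [prod_linkClass _ p q,
    hprod true true (f b = f b') (by intro S hp hq; simp [tag, hp, hq]),
    hprod true false (f b = f b' ∧ g b = g b') (by intro S hp hq; simp [tag, hp, hq]),
    hprod false true (f b = f b' ∧ h b = h b') (by intro S hp hq; simp [tag, hp, hq]),
    hprod false false False (by intro S hp hq; simp [tag, hp, hq, hb])]
  have h1 := mul_nonneg (mul_nonneg (mul_nonneg (hr true true) (hr true false)) (hr false true))
    (hr false false)
  have h2 := mul_nonneg (mul_nonneg (hr true false) (hr false true)) (hr false false)
  have h3 := mul_nonneg (hr true false) (hr false false)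
  have h4 := mul_nonneg (hr false true) (hr false false)
  have h5 := hr false false
  by_cases hf : f b = f b' <;> by_cases hg : g b = g b' <;> by_cases hh : h b = h b' <;>
    simp only [hf, hg, hh, and_self, and_true, and_false, if_true, if_false] <;>
    linarith

theorem expect_tagWeight_le [Fintype B] [Fintype U] [Fintype X] [Fintype Y] [DecidableEq B]
    [Nonempty U] [Nonempty X] [Nonempty Y] (w : Finset (Fin K) → ℕ)
    (p q k : Fin K) {b b' : B} (hb : b ≠ b') :
    𝔼 f : B → U, 𝔼 g : B → X, 𝔼 h : B → Y, tagWeight w p q k f g h b b' ≤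
      meanWeight w p q k U X Y := by
  classical
  set r := classProb w p q k with hr_def
  have hr : ∀ s t, 0 ≤ r s t := fun s t => hr_def ▸ inv_nonneg.2 (numVals_nonneg _ _)
  have hX : (0 : ℝ) ≤ (Fintype.card X : ℝ)⁻¹ := by positivity
  have hY : (0 : ℝ) ≤ (Fintype.card Y : ℝ)⁻¹ := by positivity
  have r1 := hr true true
  have r2 := hr true false
  have r3 := hr false true
  have r4 := hr false false
  have hi : ∀ Q : Prop, [Decidable Q] → (0 : ℝ) ≤ if Q then 1 else 0 := fun Q _ => by
    split_ifs <;> norm_num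
  have s1 : ∀ (f : B → U) (g : B → X), 𝔼 h : B → Y, tagWeight w p q k f g h b b' ≤
      (r true true * r true false * r false true * r false false
        + (if f b = f b' then 1 else 0) * (r true false * r false true * r false false
          + (Fintype.card Y : ℝ)⁻¹ * (r true false * r false false)))
      + (if g b = g b' then 1 else 0) * ((if f b = f b' then 1 else 0) *
        (r false true * r false false + (Fintype.card Y : ℝ)⁻¹ * r false false)) := by
    intro f g
    have hf := hi (f b = f b')
    have hg := hi (g b = g b')
    refine le_trans (Finset.expect_le_expect fun h _ =>
      (tagWeight_le w p q k f g h hb hr_def).trans (le_of_eq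
      (b := (r true true * r true false * r false true * r false false
        + (if f b = f b' then 1 else 0) * (r true false * r false true * r false false
          + (if g b = g b' then 1 else 0) * (r false true * r false false)))
        + (if h b = h b' then 1 else 0) * ((if f b = f b' then 1 else 0) *
          (r true false * r false false + (if g b = g b' then 1 else 0) * r false false))) ?_)) ?_
    · ring
    · refine (expect_add_collision_mul_le hb _ (by positivity)).trans_eq ?_
      ring
  have s2 : ∀ f : B → U, 𝔼 g : B → X, 𝔼 h : B → Y, tagWeight w p q k f g h b b' ≤
      r true true * r true false * r false true * r false false
      + (if f b = f b' then 1 else 0) * (r true false * r false true * r false false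
          + (Fintype.card X : ℝ)⁻¹ * (r false true * r false false)
          + (Fintype.card Y : ℝ)⁻¹ * (r true false * r false false
            + (Fintype.card X : ℝ)⁻¹ * r false false)) := by
    intro f
    have hf := hi (f b = f b')
    refine (Finset.expect_le_expect fun g _ => s1 f g).trans
      ((expect_add_collision_mul_le hb _ (by positivity)).trans_eq ?_)
    ring
  exact (Finset.expect_le_expect fun f _ => s2 f).trans
    (expect_add_collision_mul_le hb _ (by positivity))

end Weight

end CombNet

namespace CombNet

open scoped BigOperators

variable {K : ℕ} {A B U X Y : Type*}

theorem card_erase_product_univ [Fintype A] [DecidableEq A] [Fintype B] (a : A) :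
    (((Finset.univ.erase a) ×ˢ (Finset.univ : Finset B)).card : ℝ) =
      (Fintype.card A - 1 : ℕ) * Fintype.card B := by
  rw [Finset.card_product, Finset.card_erase_of_mem (Finset.mem_univ _), Finset.card_univ,
    Finset.card_univ, Nat.cast_mul]

section Random

/-- The codeword of the message pair `(a, b)`. -/
def codeword {w : Finset (Fin K) → ℕ} (p q : Fin K) (f : B → U) (g : B → X) (h : B → Y)
    (G : ∀ S : P K, A × Tag B U X Y → Fin (w S.1)) (a : A) (b : B) :
    ∀ S : P K, Fin (w S.1) :=
  fun S => G S (a, tag p q f g h S.1 b)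

/-- The codewords do not determine the intended messages at some receiver when `(a, b)` is sent;
`p` and `q` only want the first component. -/
def Ambiguous {w : Finset (Fin K) → ℕ} (p q : Fin K) (x : A → B → ∀ S : P K, Fin (w S.1)) (a : A)
    (b : B) : Prop :=
  ∃ k a' b', observe k (x a b) = observe k (x a' b') ∧ (a' ≠ a ∨ (k ≠ p ∧ k ≠ q ∧ b' ≠ b))

variable [Fintype A] [Fintype B] [Fintype U] [Fintype X] [Fintype Y] [DecidableEq A]
  [DecidableEq B]

/-- The number of wrong candidates that a receiver cannot exclude when `(a, b)` is sent, where `p`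
and `q` only consider the parts of the private message that reach them. -/
noncomputable def confusions {w : Finset (Fin K) → ℕ} (p q : Fin K) (f : B → U) (g : B → X)
    (h : B → Y) (G : ∀ S : P K, A × Tag B U X Y → Fin (w S.1)) (a : A)
    (b : B) : ℝ :=
  (∑ z ∈ (Finset.univ.erase a) ×ˢ (Finset.univ : Finset (U × X)),
    confusion G p (fun S => (a, tag p q f g h S b))
      fun S => (z.1, .mk z.2.1 (if q ∈ S then none else some z.2.2) none none)) +
  (∑ z ∈ (Finset.univ.erase a) ×ˢ (Finset.univ : Finset (U × Y)),
    confusion G q (fun S => (a, tag p q f g h S b))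
      fun S => (z.1, .mk z.2.1 none (if p ∈ S then none else some z.2.2) none)) +
  ∑ k ∈ Finset.univ.filter (fun k => k ≠ p ∧ k ≠ q),
    ((∑ z ∈ (Finset.univ.erase a) ×ˢ (Finset.univ : Finset B),
      confusion G k (fun S => (a, tag p q f g h S b)) fun S => (z.1, tag p q f g h S z.2)) +
    ∑ b' ∈ Finset.univ.erase b,
      confusion G k (fun S => (a, tag p q f g h S b)) fun S => (a, tag p q f g h S b'))

theorem one_le_confusions {w : Finset (Fin K) → ℕ} (p q : Fin K) (f : B → U) (g : B → X)
    (h : B → Y) (G : ∀ S : P K, A × Tag B U X Y → Fin (w S.1)) (a : A)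
    (b : B) (hbad : Ambiguous p q (codeword p q f g h G) a b) :
    1 ≤ confusions p q f g h G a b := by
  obtain ⟨k, a', b', hobs, hne⟩ := hbad
  rw [observe_eq_iff] at hobs
  have h1 := Finset.sum_nonneg (s := (Finset.univ.erase a) ×ˢ (Finset.univ : Finset (U × X)))
    fun z _ => confusion_nonneg G p (fun S => (a, tag p q f g h S b))
      fun S => (z.1, .mk z.2.1 (if q ∈ S then none else some z.2.2) none none)
  have h2 := Finset.sum_nonneg (s := (Finset.univ.erase a) ×ˢ (Finset.univ : Finset (U × Y)))
    fun z _ => confusion_nonneg G q (fun S => (a, tag p q f g h S b))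
      fun S => (z.1, .mk z.2.1 none (if p ∈ S then none else some z.2.2) none)
  have h3 := fun k => Finset.sum_nonneg
    (s := (Finset.univ.erase a) ×ˢ (Finset.univ : Finset B)) fun z _ =>
      confusion_nonneg G k (fun S => (a, tag p q f g h S b)) fun S => (z.1, tag p q f g h S z.2)
  have h4 := fun k => Finset.sum_nonneg (s := Finset.univ.erase b) fun b' _ =>
    confusion_nonneg G k (fun S => (a, tag p q f g h S b)) fun S => (a, tag p q f g h S b')
  have h5 := Finset.sum_nonneg (s := Finset.univ.filter (fun k => k ≠ p ∧ k ≠ q))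
    fun k _ => add_nonneg (h3 k) (h4 k)
  unfold confusions
  by_cases hp : k = p
  · subst hp
    have ha : a' ≠ a := by tauto
    have hone := Finset.single_le_sum (s := (Finset.univ.erase a) ×ˢ (Finset.univ : Finset (U × X)))
      (fun z _ => confusion_nonneg G k (fun S => (a, tag k q f g h S b))
      fun S => (z.1, .mk z.2.1 (if q ∈ S then none else some z.2.2) none none))
      (a := (a', f b', g b')) (by simp [ha])
    have hval : confusion G k (fun S => (a, tag k q f g h S b))
      (fun S => (a', .mk (f b') (if q ∈ S then none else some (g b')) none none)) = 1 :=
      if_pos fun S hS => by simpa [codeword, tag, hS] using hobs S hS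
    simp only [hval] at hone
    linarith
  by_cases hq : k = q
  · subst hq
    have ha : a' ≠ a := by tauto
    have hone := Finset.single_le_sum (s := (Finset.univ.erase a) ×ˢ (Finset.univ : Finset (U × Y)))
      (fun z _ => confusion_nonneg G k (fun S => (a, tag p k f g h S b))
      fun S => (z.1, .mk z.2.1 none (if p ∈ S then none else some z.2.2) none))
      (a := (a', f b', h b')) (by simp [ha])
    have hval : confusion G k (fun S => (a, tag p k f g h S b))
      (fun S => (a', .mk (f b') none (if p ∈ S then none else some (h b')) none)) = 1 :=
      if_pos fun S hS => by simpa [codeword, tag, hS] using hobs S hS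
    simp only [hval] at hone
    linarith
  have hk := Finset.single_le_sum (s := Finset.univ.filter (fun k => k ≠ p ∧ k ≠ q))
    (fun k _ => add_nonneg (h3 k) (h4 k)) (a := k) (by simp [hp, hq])
  by_cases ha : a' = a
  · subst ha
    have hb : b' ≠ b := by tauto
    have hone := Finset.single_le_sum (s := Finset.univ.erase b) (fun b'' _ =>
      confusion_nonneg G k (fun S => (a', tag p q f g h S b)) fun S => (a', tag p q f g h S b''))
      (a := b') (by simp [hb])
    have hval : confusion G k (fun S => (a', tag p q f g h S b))
        (fun S => (a', tag p q f g h S b')) = 1 := if_pos fun S hS => hobs S hS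
    have := h3 k
    simp only [hval] at hone
    linarith
  · have hone := Finset.single_le_sum
      (s := (Finset.univ.erase a) ×ˢ (Finset.univ : Finset B)) (fun z _ =>
        confusion_nonneg G k (fun S => (a, tag p q f g h S b)) fun S => (z.1, tag p q f g h S z.2))
      (a := (a', b')) (by simp [ha])
    have hval : confusion G k (fun S => (a, tag p q f g h S b))
        (fun S => (a', tag p q f g h S b')) = 1 := if_pos fun S hS => hobs S hS
    have := h4 k
    simp only [hval] at hone
    linarith

theorem expect_confusion_le_of_ne {T : Type*} [Fintype T] [DecidableEq T]
    {w : Finset (Fin K) → ℕ}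
    (hw : ∀ S ∈ P K, 0 < w S) (k : Fin K) {a a' : A} (ha : a ≠ a') (d d' : Finset (Fin K) → T) :
    𝔼 G : (∀ S : P K, A × T → Fin (w S.1)), confusion G k (fun S => (a, d S)) (fun S => (a', d' S))
      ≤ (numVals w (W k (P K)))⁻¹ := by
  refine (expect_confusion_le hw k _ _).trans_eq ?_
  rw [numVals, ← Finset.prod_inv_distrib]
  refine Finset.prod_congr rfl fun S _ => ?_
  rw [if_neg fun h => ha (congrArg Prod.fst h)]

theorem expect_confusions_le {w : Finset (Fin K) → ℕ} (hw : ∀ S ∈ P K, 0 < w S) (p q : Fin K)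
    (f : B → U) (g : B → X) (h : B → Y) (a : A) (b : B) :
    𝔼 G : (∀ S : P K, A × Tag B U X Y → Fin (w S.1)),
      confusions p q f g h G a b ≤
    ((Fintype.card A - 1 : ℕ) * (Fintype.card U * Fintype.card X)) * (numVals w (W p (P K)))⁻¹ +
    ((Fintype.card A - 1 : ℕ) * (Fintype.card U * Fintype.card Y)) * (numVals w (W q (P K)))⁻¹ +
    ∑ k ∈ Finset.univ.filter (fun k => k ≠ p ∧ k ≠ q),
      (((Fintype.card A - 1 : ℕ) * Fintype.card B) * (numVals w (W k (P K)))⁻¹ +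
      ∑ b' ∈ Finset.univ.erase b, tagWeight w p q k f g h b b') := by
  unfold confusions
  simp only [Finset.expect_add_distrib, Finset.expect_sum_comm]
  refine add_le_add (add_le_add ?_ ?_) (Finset.sum_le_sum fun k _ => add_le_add ?_ ?_)
  · refine le_trans (Finset.sum_le_card_nsmul _ _ (numVals w (W p (P K)))⁻¹ fun z hz => ?_)
      (le_of_eq ?_)
    · exact expect_confusion_le_of_ne hw p
        (Finset.ne_of_mem_erase (Finset.mem_product.1 hz).1).symm (fun S => tag p q f g h S b)
        (fun S => Tag.mk z.2.1 (if q ∈ S then none else some z.2.2) none none)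
    rw [nsmul_eq_mul, card_erase_product_univ, Fintype.card_prod, Nat.cast_mul]
  · refine le_trans (Finset.sum_le_card_nsmul _ _ (numVals w (W q (P K)))⁻¹ fun z hz => ?_)
      (le_of_eq ?_)
    · exact expect_confusion_le_of_ne hw q
        (Finset.ne_of_mem_erase (Finset.mem_product.1 hz).1).symm (fun S => tag p q f g h S b)
        (fun S => Tag.mk z.2.1 none (if p ∈ S then none else some z.2.2) none)
    rw [nsmul_eq_mul, card_erase_product_univ, Fintype.card_prod, Nat.cast_mul]
  · refine le_trans (Finset.sum_le_card_nsmul _ _ (numVals w (W k (P K)))⁻¹ fun z hz => ?_)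
      (le_of_eq ?_)
    · exact expect_confusion_le_of_ne hw k
        (Finset.ne_of_mem_erase (Finset.mem_product.1 hz).1).symm (fun S => tag p q f g h S b)
        (fun S => tag p q f g h S z.2)
    rw [nsmul_eq_mul, card_erase_product_univ]
  · refine Finset.sum_le_sum fun b' _ => le_trans (expect_confusion_le hw k _ _) (le_of_eq ?_)
    refine Finset.prod_congr rfl fun S _ => if_congr ?_ rfl rfl
    simp only [Prod.mk.injEq, true_and]

/-- A bound for the fraction of ambiguous message pairs in a random code. -/
noncomputable def ambiguityBound (w : Finset (Fin K) → ℕ) (p q : Fin K) (A B U X Y : Type*)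
    [Fintype A] [Fintype B] [Fintype U] [Fintype X] [Fintype Y] : ℝ :=
  ((Fintype.card A - 1 : ℕ) * (Fintype.card U * Fintype.card X)) * (numVals w (W p (P K)))⁻¹ +
  ((Fintype.card A - 1 : ℕ) * (Fintype.card U * Fintype.card Y)) * (numVals w (W q (P K)))⁻¹ +
  ∑ k ∈ Finset.univ.filter (fun k => k ≠ p ∧ k ≠ q),
    (((Fintype.card A - 1 : ℕ) * Fintype.card B) * (numVals w (W k (P K)))⁻¹ +
      (Fintype.card B - 1 : ℕ) * meanWeight w p q k U X Y)

theorem exists_codewords [Nonempty U] [Nonempty X] [Nonempty Y] {w : Finset (Fin K) → ℕ}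
    (hw : ∀ S ∈ P K, 0 < w S) (p q : Fin K) :
    ∃ x : A → B → ∀ S : P K, Fin (w S.1),
      ∀ s : Finset (A × B), (∀ ab ∈ s, Ambiguous p q x ab.1 ab.2) → (s.card : ℝ) ≤
        Fintype.card (A × B) * ambiguityBound w p q A B U X Y := by
  set c := fun (f : B → U) (g : B → X) (h : B → Y) => ∑ ab : A × B,
    (((Fintype.card A - 1 : ℕ) * (Fintype.card U * Fintype.card X)) * (numVals w (W p (P K)))⁻¹ +
    ((Fintype.card A - 1 : ℕ) * (Fintype.card U * Fintype.card Y)) * (numVals w (W q (P K)))⁻¹ +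
    ∑ k ∈ Finset.univ.filter (fun k => k ≠ p ∧ k ≠ q),
      (((Fintype.card A - 1 : ℕ) * Fintype.card B) * (numVals w (W k (P K)))⁻¹ +
      ∑ b' ∈ Finset.univ.erase ab.2, tagWeight w p q k f g h ab.2 b')) with hc
  have hmean : 𝔼 f, 𝔼 g, 𝔼 h, c f g h ≤
      Fintype.card (A × B) * ambiguityBound w p q A B U X Y := by
    simp only [hc, Finset.expect_add_distrib, Finset.expect_sum_comm, Fintype.expect_const]
    refine le_trans (Finset.sum_le_card_nsmul _ _ (ambiguityBound w p q A B U X Y)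
      fun ab _ => ?_) (by rw [nsmul_eq_mul, Finset.card_univ])
    unfold ambiguityBound
    refine add_le_add le_rfl (Finset.sum_le_sum fun k _ => add_le_add le_rfl ?_)
    refine le_trans (Finset.sum_le_card_nsmul _ _ (meanWeight w p q k U X Y) fun b' hb' =>
      expect_tagWeight_le w p q k (Finset.ne_of_mem_erase hb').symm) ?_
    rw [nsmul_eq_mul, Finset.card_erase_of_mem (Finset.mem_univ _), Finset.card_univ]
  obtain ⟨f, -, hf⟩ := Finset.exists_le_of_expect_le Finset.univ_nonempty hmean
  obtain ⟨g, -, hg⟩ := Finset.exists_le_of_expect_le Finset.univ_nonempty hf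
  obtain ⟨h, -, hh⟩ := Finset.exists_le_of_expect_le Finset.univ_nonempty hg
  have : ∀ S : P K, Nonempty (Fin (w S.1)) := fun S => ⟨⟨0, hw _ S.2⟩⟩
  have hG : 𝔼 G : (∀ S : P K, A × Tag B U X Y → Fin (w S.1)),
      ∑ ab : A × B, confusions p q f g h G ab.1 ab.2 ≤ c f g h := by
    rw [Finset.expect_sum_comm]
    exact Finset.sum_le_sum fun ab _ => expect_confusions_le hw p q f g h ab.1 ab.2
  obtain ⟨G, -, hG'⟩ := Finset.exists_le_of_expect_le Finset.univ_nonempty (hG.trans hh)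
  refine ⟨codeword p q f g h G, fun s hs => le_trans ?_ hG'⟩
  rw [Finset.cast_card]
  refine (Finset.sum_le_sum fun ab hab => one_le_confusions p q f g h G ab.1 ab.2
    (hs ab hab)).trans (Finset.sum_le_sum_of_subset_of_nonneg
      (Finset.subset_univ _) fun ab _ _ => ?_)
  unfold confusions
  refine add_nonneg (add_nonneg ?_ ?_) (Finset.sum_nonneg fun k _ => add_nonneg ?_ ?_) <;>
  exact Finset.sum_nonneg fun _ _ => confusion_nonneg _ _ _ _

end Random

/-- A code for the two messages whose error probability is bounded as for random codes. -/
theorem exists_code (hK : 2 ≤ K) {p q : Fin K} (hpq : commonRecv K = {p, q})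
    (U X Y : Type*) [Fintype U] [Fintype X] [Fintype Y] [Nonempty U] [Nonempty X] [Nonempty Y]
    {w : Finset (Fin K) → ℕ} (hw : ∀ S ∈ P K, 0 < w S) {M : nested K → ℕ} (hM : ∀ S, 0 < M S) :
    ∃ c : Code (combChannel w) (nested K) M, c.errorProb ≤
      ambiguityBound w p q (Fin (M (idxC K))) (Fin (M (idxP K))) U X Y := by
  classical
  obtain ⟨x, hx⟩ := exists_codewords (A := Fin (M (idxC K))) (B := Fin (M (idxP K))) (U := U)
    (X := X) (Y := Y) hw p q
  obtain ⟨c, hc⟩ := exists_code_of_enc hM fun m => x (m (idxC K)) (m (idxP K))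
  refine ⟨c, hc.trans ?_⟩
  have h1 := hM (idxC K)
  have h2 := hM (idxP K)
  rw [card_message hK, div_le_iff₀ (by exact_mod_cast Nat.mul_pos h1 h2), mul_comm]
  rw [Fintype.card_prod, Fintype.card_fin, Fintype.card_fin] at hx
  rw [← Finset.card_image_of_injective (f := fun m : ∀ S, Fin (M S) => (m (idxC K), m (idxP K))) _
    fun m m' h => message_ext (congrArg Prod.fst h) (congrArg Prod.snd h)]
  refine hx _ fun ab hab => ?_
  obtain ⟨m, hm, rfl⟩ := Finset.mem_image.1 hab
  obtain ⟨k, m', hobs, S, hkS, hS⟩ := (Finset.mem_filter.1 hm).2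
  refine ⟨k, _, _, hobs, ?_⟩
  rcases eq_idxC_or_eq_idxP S with rfl | rfl
  · exact Or.inl hS
  · have : k ∉ commonRecv K := mem_privRecv.1 hkS
    rw [hpq, Finset.mem_insert, Finset.mem_singleton, not_or] at this
    exact Or.inr ⟨this.1, this.2, hS⟩

end CombNet

namespace CombNet

variable {K : ℕ}

/-! ### The rates of the hashes -/

theorem cap_eq_linkClass (C : Finset (Fin K) → ℝ) (F : Finset (Finset (Fin K))) (p q : Fin K) :
    cap C F = (cap C (linkClass F p q true true) + cap C (linkClass F p q true false)) +
      (cap C (linkClass F p q false true) + cap C (linkClass F p q false false)) :=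
  sum_linkClass F p q C

theorem cap_nonneg {C : Finset (Fin K) → ℝ} (hC : ∀ S ∈ P K, 0 ≤ C S)
    {F : Finset (Finset (Fin K))} (hF : F ⊆ P K) : 0 ≤ cap C F :=
  Finset.sum_nonneg fun S hS => hC S (hF hS)

theorem linkClass_subset_P {k p q : Fin K} {s t : Bool} : linkClass (W k (P K)) p q s t ⊆ P K :=
  (Finset.filter_subset _ _).trans W_subset

theorem cap_add_cap_le {C : Finset (Fin K) → ℝ} (hC : ∀ S ∈ P K, 0 ≤ C S)
    {F₁ F₂ F : Finset (Finset (Fin K))} (hd : Disjoint F₁ F₂) (h₁ : F₁ ⊆ F) (h₂ : F₂ ⊆ F)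
    (hF : F ⊆ P K) : cap C F₁ + cap C F₂ ≤ cap C F := by
  classical
  unfold cap
  rw [← Finset.sum_union hd]
  exact Finset.sum_le_sum_of_subset_of_nonneg (Finset.union_subset h₁ h₂) fun S hS _ => hC S (hF hS)

theorem cap_linkClass_add_le_left {C : Finset (Fin K) → ℝ} (hC : ∀ S ∈ P K, 0 ≤ C S)
    (p q i j : Fin K) : cap C (linkClass (W i (P K)) p q true true) +
      cap C (linkClass (W j (P K)) p q true false) ≤ cap C (W p (P K)) := by
  refine cap_add_cap_le hC (Finset.disjoint_left.2 fun S h h' => ?_) (fun S h => ?_)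
    (fun S h => ?_) W_subset <;>
  simp only [linkClass, W, Finset.mem_filter] at * <;> simp_all

theorem cap_linkClass_add_le_right {C : Finset (Fin K) → ℝ} (hC : ∀ S ∈ P K, 0 ≤ C S)
    (p q i j : Fin K) : cap C (linkClass (W i (P K)) p q true true) +
      cap C (linkClass (W j (P K)) p q false true) ≤ cap C (W q (P K)) := by
  refine cap_add_cap_le hC (Finset.disjoint_left.2 fun S h h' => ?_) (fun S h => ?_)
    (fun S h => ?_) W_subset <;>
  simp only [linkClass, W, Finset.mem_filter] at * <;> simp_all

theorem exists_hash_rates {C : Finset (Fin K) → ℝ} (hC : ∀ S ∈ P K, 0 ≤ C S) {p q : Fin K}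
    {s : Finset (Fin K)} (hs : s.Nonempty) {rc rp : ℝ} (hp : rc ≤ cap C (W p (P K)))
    (hq : rc ≤ cap C (W q (P K))) (h1 : ∀ j ∈ s, rc + rp ≤ cap C (W j (P K)))
    (h2 : ∀ j ∈ s, 2 * rc + rp ≤ cap C (linkClass (W j (P K)) p q false false) +
      (cap C (W p (P K)) + cap C (W q (P K)))) :
    ∃ u x y : ℝ, 0 ≤ u ∧ 0 ≤ x ∧ 0 ≤ y ∧ rc + u + x ≤ cap C (W p (P K)) ∧
      rc + u + y ≤ cap C (W q (P K)) ∧ ∀ j ∈ s,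
        let c := fun s t => cap C (linkClass (W j (P K)) p q s t)
        rp ≤ u + c true false + c false true + c false false ∧
        rp ≤ u + x + c false true + c false false ∧
        rp ≤ u + y + c true false + c false false ∧
        rp ≤ u + x + y + c false false := by
  set c := fun j s t => cap C (linkClass (W j (P K)) p q s t) with hc
  obtain ⟨i, hi, hmax⟩ := Finset.exists_max_image s
    (fun j => rp - c j true false - c j false true - c j false false) hs
  have hnn : ∀ j s t, 0 ≤ c j s t := fun j s t => cap_nonneg hC linkClass_subset_P
  have hL : ∀ i j, c i true true + c j true false ≤ cap C (W p (P K)) :=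
    cap_linkClass_add_le_left hC p q
  have hR : ∀ i j, c i true true + c j false true ≤ cap C (W q (P K)) :=
    cap_linkClass_add_le_right hC p q
  have hT : ∀ j, cap C (W j (P K)) = (c j true true + c j true false) +
    (c j false true + c j false false) := fun j => cap_eq_linkClass C _ p q
  set u := max 0 (rp - c i true false - c i false true - c i false false) with hu
  have hu0 : 0 ≤ u := le_max_left _ _
  have hi1 := h1 i hi
  rw [hT] at hi1
  have hup : u ≤ cap C (W p (P K)) - rc := by
    refine max_le (by linarith) ?_
    linarith [hL i i, hnn i true false]
  have huq : u ≤ cap C (W q (P K)) - rc := by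
    refine max_le (by linarith) ?_
    linarith [hR i i, hnn i false true]
  refine ⟨u, cap C (W p (P K)) - rc - u, cap C (W q (P K)) - rc - u, hu0, by linarith, by linarith,
    by linarith, by linarith, fun j hj => ?_⟩
  have hj1 := h1 j hj
  have hj2 := h2 j hj
  rw [hT] at hj1
  have hj3 := hmax j hj
  have hj4 : rp - c i true false - c i false true - c i false false ≤ u := le_max_right _ _
  refine ⟨by linarith, by linarith [hL j j], by linarith [hR j j], ?_⟩
  change rp ≤ _ + c j false false
  have : u ≤ c j false false + (cap C (W p (P K)) + cap C (W q (P K))) - 2 * rc - rp := by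
    refine max_le (by linarith) ?_
    linarith [hL j j, hR i j]
  linarith

/-! ### Decay of the error probability -/

/-- The non-negative sequence `s` is bounded by a multiple of `2 ^ (n σ)`. -/
def ExpBounded (s : ℕ → ℝ) (σ : ℝ) : Prop :=
  ∃ c : ℝ, ∀ n : ℕ, 0 ≤ s n ∧ s n ≤ c * 2 ^ ((n : ℝ) * σ)

theorem ExpBounded.mul {s t : ℕ → ℝ} {σ τ : ℝ} (hs : ExpBounded s σ) (ht : ExpBounded t τ) :
    ExpBounded (fun n => s n * t n) (σ + τ) := by
  obtain ⟨c, hc⟩ := hs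
  obtain ⟨d, hd⟩ := ht
  refine ⟨c * d, fun n => ⟨mul_nonneg (hc n).1 (hd n).1, ?_⟩⟩
  refine (mul_le_mul (hc n).2 (hd n).2 (hd n).1 ((hc n).1.trans (hc n).2)).trans_eq ?_
  rw [mul_add, Real.rpow_add two_pos]
  ring

theorem ExpBounded.add {s t : ℕ → ℝ} {σ : ℝ} (hs : ExpBounded s σ) (ht : ExpBounded t σ) :
    ExpBounded (fun n => s n + t n) σ := by
  obtain ⟨c, hc⟩ := hs
  obtain ⟨d, hd⟩ := ht
  refine ⟨c + d, fun n => ⟨add_nonneg (hc n).1 (hd n).1, ?_⟩⟩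
  rw [add_mul]
  exact add_le_add (hc n).2 (hd n).2

theorem ExpBounded.mono {s : ℕ → ℝ} {σ τ : ℝ} (hs : ExpBounded s σ) (h : σ ≤ τ) :
    ExpBounded s τ := by
  obtain ⟨c, hc⟩ := hs
  refine ⟨c, fun n => ⟨(hc n).1, (hc n).2.trans ?_⟩⟩
  have hc0 : 0 ≤ c := nonneg_of_mul_nonneg_left ((hc n).1.trans (hc n).2) (by positivity)
  gcongr
  exact one_le_two

theorem expBounded_floor (r : ℝ) : ExpBounded (fun n => (⌊(2 : ℝ) ^ ((n : ℝ) * r)⌋₊ : ℝ)) r :=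
  ⟨1, fun n => ⟨Nat.cast_nonneg _, by rw [one_mul]; exact Nat.floor_le (by positivity)⟩⟩

theorem expBounded_inv_floor {r : ℝ} (hr : 0 ≤ r) :
    ExpBounded (fun n => (⌊(2 : ℝ) ^ ((n : ℝ) * r)⌋₊ : ℝ)⁻¹) (-r) := by
  refine ⟨2, fun n => ⟨by positivity, ?_⟩⟩
  have h := le_two_mul_floor (one_le_two_rpow n hr)
  have h0 : (0 : ℝ) < ⌊(2 : ℝ) ^ ((n : ℝ) * r)⌋₊ := Nat.cast_pos.2 (floor_two_rpow_pos n hr)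
  rw [mul_neg, Real.rpow_neg two_pos.le, ← div_eq_mul_inv, le_div_iff₀ (by positivity),
    ← div_eq_inv_mul, div_le_iff₀ h0]
  exact h

theorem LinkSizes.pos {C : Finset (Fin K) → ℝ} {w : ℕ → Finset (Fin K) → ℕ} (h : LinkSizes C w)
    (n : ℕ) {S : Finset (Fin K)} (hS : S ∈ P K) : 0 < w n S := by
  have h1 := h.ge n S hS
  have h2 : (0 : ℝ) < 2 ^ ((n : ℝ) * C S) := by positivity
  have h3 : (0 : ℝ) < w n S := by linarith
  exact_mod_cast h3

theorem LinkSizes.expBounded {C : Finset (Fin K) → ℝ} {w : ℕ → Finset (Fin K) → ℕ}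
    (h : LinkSizes C w) {F : Finset (Finset (Fin K))} (hF : F ⊆ P K) :
    ExpBounded (fun n => (numVals (w n) F)⁻¹) (-cap C F) := by
  refine ⟨2 ^ F.card, fun n => ⟨inv_nonneg.2 (numVals_nonneg _ _), ?_⟩⟩
  have h0 : 0 < numVals (w n) F :=
    Finset.prod_pos fun S hS => Nat.cast_pos.2 (h.pos n (hF hS))
  rw [mul_neg, Real.rpow_neg two_pos.le, ← div_eq_mul_inv, le_div_iff₀ (by positivity),
    ← div_eq_inv_mul, div_le_iff₀ h0, two_rpow_cap, numVals, ← Finset.prod_const,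
    ← Finset.prod_mul_distrib]
  exact Finset.prod_le_prod (fun S _ => by positivity) fun S hS => h.ge n S (hF hS)

theorem ExpBounded.tendsto_floor_sub_one_mul {s : ℕ → ℝ} {σ ρ : ℝ} (hs : ExpBounded s σ)
    (hρ : ρ = 0 ∨ ρ + σ < 0) :
    Tendsto (fun n : ℕ => ((⌊(2 : ℝ) ^ ((n : ℝ) * ρ)⌋₊ - 1 : ℕ) : ℝ) * s n) atTop (𝓝 0) := by
  rcases hρ with rfl | hρ
  · simp
  · obtain ⟨c, hc⟩ := (expBounded_floor ρ).mul hs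
    have ht : Tendsto (fun n : ℕ => c * (2 : ℝ) ^ ((n : ℝ) * (ρ + σ))) atTop (𝓝 0) := by
      simp only [two_rpow_nat_mul]
      have := (tendsto_pow_atTop_nhds_zero_of_lt_one (r := (2 : ℝ) ^ (ρ + σ)) (by positivity)
        (Real.rpow_lt_one_of_one_lt_of_neg one_lt_two hρ)).const_mul c
      rwa [mul_zero] at this
    have hs0 : ∀ n, 0 ≤ s n := fun n => hs.elim fun _ h => (h n).1
    refine squeeze_zero (fun n => mul_nonneg (Nat.cast_nonneg _) (hs0 n)) (fun n => ?_) ht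
    exact (mul_le_mul_of_nonneg_right (Nat.cast_le.2 (Nat.sub_le _ _)) (hs0 n)).trans (hc n).2

theorem expBounded_meanWeight {C : Finset (Fin K) → ℝ} {w : ℕ → Finset (Fin K) → ℕ}
    (hw : LinkSizes C w) {p q k : Fin K} {u x y rp : ℝ} (hu : 0 ≤ u) (hx : 0 ≤ x) (hy : 0 ≤ y)
    (h0 : rp ≤ cap C (W k (P K))) {c : Bool → Bool → ℝ}
    (hc : c = fun s t => cap C (linkClass (W k (P K)) p q s t))
    (h1 : rp ≤ u + c true false + c false true + c false false)
    (h2 : rp ≤ u + x + c false true + c false false)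
    (h3 : rp ≤ u + y + c true false + c false false)
    (h4 : rp ≤ u + x + y + c false false) :
    ExpBounded (fun n => meanWeight (w n) p q k (Fin ⌊(2 : ℝ) ^ ((n : ℝ) * u)⌋₊)
      (Fin ⌊(2 : ℝ) ^ ((n : ℝ) * x)⌋₊) (Fin ⌊(2 : ℝ) ^ ((n : ℝ) * y)⌋₊)) (-rp) := by
  have hr : ∀ s t, ExpBounded (fun n => classProb (w n) p q k s t) (-c s t) := fun s t => by
    rw [hc]
    exact hw.expBounded linkClass_subset_P
  rw [cap_eq_linkClass C _ p q] at h0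
  have h0' : rp ≤ (c true true + c true false) + (c false true + c false false) := by
    rw [hc]
    exact h0
  have hU := expBounded_inv_floor hu
  have hX := expBounded_inv_floor hx
  have hY := expBounded_inv_floor hy
  have e0 := (((hr true true).mul (hr true false)).mul (hr false true)).mul (hr false false)
  have e1 := hU.mul (((hr true false).mul (hr false true)).mul (hr false false))
  have e2 := (hU.mul hX).mul ((hr false true).mul (hr false false))
  have e3 := (hU.mul hY).mul ((hr true false).mul (hr false false))
  have e4 := ((hU.mul hY).mul hX).mul (hr false false)
  have e := ((((e0.mono (τ := -rp) (by linarith)).add (e1.mono (by linarith))).add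
    (e2.mono (by linarith))).add (e3.mono (by linarith))).add (e4.mono (by linarith))
  convert e using 2 with n
  simp only [meanWeight, Fintype.card_fin]
  ring

/-! ### Achievability -/

theorem linkClass_false_false {p q j : Fin K} (hpq : commonRecv K = {p, q}) :
    linkClass (W j (P K)) p q false false = downIn (W j (P K)) {privRecv K} := by
  ext S
  rw [mem_downIn_privRecv, hpq]
  simp [linkClass]

theorem achievable_smul (hK : 3 ≤ K) {C : Finset (Fin K) → ℝ} (hC : ∀ S ∈ P K, 0 ≤ C S)
    {w : ℕ → Finset (Fin K) → ℕ} (hw : LinkSizes C w) {R : nested K → ℝ} (hR : R ∈ region C)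
    {θ : ℝ} (hθ0 : 0 ≤ θ) (hθ1 : θ < 1) :
    Achievable (fun n => combChannel (w n)) (nested K) (θ • R) := by
  obtain ⟨p, q, hne, hpq⟩ := exists_commonRecv_eq (K := K) (by omega)
  obtain ⟨hc0, hp0, hc, hcp, h2⟩ := hR
  have hpriv : ∀ {k}, k ∈ privRecv K ↔ k ≠ p ∧ k ≠ q := fun {k} => by
    rw [mem_privRecv, hpq]
    simp
  obtain ⟨u, x, y, hu, hx, hy, hup, huq, hj⟩ := exists_hash_rates hC (p := p) (q := q)
    (privRecv_nonempty hK) (hc p (by simp [hpq])) (hc q (by simp [hpq])) hcp fun j hj => by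
      have := h2 j hj
      rwa [hpq, Finset.sum_pair hne, ← linkClass_false_false hpq] at this
  have hR0 : ∀ S, 0 ≤ (θ • R) S := fun S => by
    refine mul_nonneg hθ0 ?_
    rcases eq_idxC_or_eq_idxP S with rfl | rfl
    · exact hc0
    · exact hp0
  refine ⟨hR0, ?_⟩
  have hFin : ∀ (n : ℕ) {r : ℝ}, 0 ≤ r → Nonempty (Fin ⌊(2 : ℝ) ^ ((n : ℝ) * r)⌋₊) :=
    fun n r hr => ⟨⟨0, floor_two_rpow_pos n hr⟩⟩
  have hcode := fun n : ℕ =>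
    haveI := hFin n hu
    haveI := hFin n hx
    haveI := hFin n hy
    exists_code (K := K) (by omega) hpq (Fin ⌊(2 : ℝ) ^ ((n : ℝ) * u)⌋₊)
      (Fin ⌊(2 : ℝ) ^ ((n : ℝ) * x)⌋₊) (Fin ⌊(2 : ℝ) ^ ((n : ℝ) * y)⌋₊) (fun S hS => hw.pos n hS)
      (M := fun S => ⌊(2 : ℝ) ^ ((n : ℝ) * (θ • R) S)⌋₊) fun S => floor_two_rpow_pos n (hR0 S)
  choose c hcb using hcode
  refine ⟨c, squeeze_zero (fun n => ?_) hcb ?_⟩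
  · rw [Code.errorProb_combChannel]
    positivity
  have hlt : ∀ {r : ℝ}, 0 ≤ r → θ * r = 0 ∨ θ * r < r := fun {r} hr => by
    rcases hr.eq_or_lt with rfl | hr
    · exact Or.inl (mul_zero _)
    · exact Or.inr (by nlinarith)
  have hle : θ * R (idxP K) ≤ R (idxP K) := mul_le_of_le_one_left hp0 hθ1.le
  have hltC : θ * R (idxC K) = 0 ∨ θ * R (idxC K) < R (idxC K) := hlt hc0
  have hltP : θ * R (idxP K) = 0 ∨ θ * R (idxP K) < R (idxP K) := hlt hp0
  change R (idxC K) + u + x ≤ _ at hup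
  change R (idxC K) + u + y ≤ _ at huq
  have hcp' : ∀ j ∈ privRecv K, R (idxC K) + R (idxP K) ≤ cap C (W j (P K)) := hcp
  have t1 := (((expBounded_floor u).mul (expBounded_floor x)).mul
    (hw.expBounded (F := W p (P K)) W_subset)).tendsto_floor_sub_one_mul (ρ := θ * R (idxC K))
    (hltC.imp_right fun h => by linarith)
  have t2 := (((expBounded_floor u).mul (expBounded_floor y)).mul
    (hw.expBounded (F := W q (P K)) W_subset)).tendsto_floor_sub_one_mul (ρ := θ * R (idxC K))
    (hltC.imp_right fun h => by linarith)
  have t3 : ∀ k ∈ Finset.univ.filter (fun k => k ≠ p ∧ k ≠ q), _ := fun k hk =>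
    have hk' := hpriv.2 (Finset.mem_filter.1 hk).2
    ((expBounded_floor (θ * R (idxP K))).mul
      (hw.expBounded (F := W k (P K)) W_subset)).tendsto_floor_sub_one_mul (ρ := θ * R (idxC K))
      (hltC.imp_right fun h => by linarith [hcp' k hk'])
  have t4 : ∀ k ∈ Finset.univ.filter (fun k => k ≠ p ∧ k ≠ q), _ := fun k hk =>
    have hk' := hpriv.2 (Finset.mem_filter.1 hk).2
    have hk'' := hj k hk'
    (expBounded_meanWeight hw (p := p) (q := q) (k := k) (rp := R (idxP K)) hu hx hy
      (le_trans (le_add_of_nonneg_left hc0) (hcp' k hk')) rfl hk''.1 hk''.2.1 hk''.2.2.1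
      hk''.2.2.2).tendsto_floor_sub_one_mul (ρ := θ * R (idxP K))
      (hltP.imp_right fun h => by linarith)
  have t := (t1.add t2).add (tendsto_finsetSum _ fun k hk => (t3 k hk).add (t4 k hk))
  simp only [add_zero, Finset.sum_const_zero] at t
  refine t.congr fun n => ?_
  simp only [ambiguityBound, Fintype.card_fin, Pi.smul_apply, smul_eq_mul, mul_assoc]

theorem capacityRegion_eq_region (hK : 3 ≤ K) {C : Finset (Fin K) → ℝ}
    (hC : ∀ S ∈ P K, 0 ≤ C S) {w : ℕ → Finset (Fin K) → ℕ} (hw : LinkSizes C w) :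
    capacityRegion (fun n => combChannel (w n)) (nested K) = region C := by
  refine (capacityRegion_subset_region (by omega) hw).antisymm fun R hR => ?_
  have ht : Tendsto (fun θ : ℝ => θ • R) (𝓝[<] 1) (𝓝 R) := by
    have : Continuous fun θ : ℝ => θ • R := by fun_prop
    simpa using (this.tendsto 1).mono_left nhdsWithin_le_nhds
  refine mem_closure_of_tendsto ht ?_
  filter_upwards [Ioo_mem_nhdsLT (zero_lt_one' ℝ)] with θ hθ
  exact achievable_smul hK hC hw hR hθ.1.le hθ.2

theorem linkSizes_floor {C : Finset (Fin K) → ℝ} (hC : ∀ S ∈ P K, 0 ≤ C S) :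
    LinkSizes C fun n S => ⌊(2 : ℝ) ^ ((n : ℝ) * C S)⌋₊ :=
  ⟨fun _ _ _ => Nat.floor_le (by positivity),
    fun n S hS => le_two_mul_floor (one_le_two_rpow n (hC S hS))⟩

theorem linkSizes_pow {C : Finset (Fin K) → ℝ} {v : Finset (Fin K) → ℕ}
    (hv : ∀ S ∈ P K, (v S : ℝ) = (2 : ℝ) ^ C S) : LinkSizes C fun n S => v S ^ n := by
  have h : ∀ n : ℕ, ∀ S ∈ P K, ((v S ^ n : ℕ) : ℝ) = 2 ^ ((n : ℝ) * C S) := fun n S hS => by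
    rw [Nat.cast_pow, hv S hS, two_rpow_nat_mul]
  exact ⟨fun n S hS => (h n S hS).le,
    fun n S hS => by rw [h n S hS]; linarith [Real.rpow_pos_of_pos two_pos ((n : ℝ) * C S)]⟩

end CombNet

theorem mainTheorem7 (K : ℕ) (hK : 3 ≤ K) (C : Finset (Fin K) → ℝ)
    (hC : ∀ S ∈ CombNet.P K, 0 ≤ C S) :
    CombNet.capacityRegion (CombNet.combLinks C) (CombNet.nested K) = CombNet.region C ∧
    ∀ v : Finset (Fin K) → ℕ, (∀ S ∈ CombNet.P K, (v S : ℝ) = (2 : ℝ) ^ C S) →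
      CombNet.capacityRegion (CombNet.combDMBC v) (CombNet.nested K) = CombNet.region C := by
  refine ⟨CombNet.capacityRegion_eq_region hK hC (CombNet.linkSizes_floor hC), fun v hv => ?_⟩
  rw [CombNet.capacityRegion_combDMBC]
  exact CombNet.capacityRegion_eq_region hK hC (CombNet.linkSizes_pow hv)
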